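/- Let $A,C\in\mathbb R^{n\times n}$, $B,D\in\mathbb R^{n\times m}$, let $Q\in\mathbb R^{n\times n}$ and $R\in\mathbb R^{m\times m}$ be symmetric positive definite, let $X_0,W\in\mathbb R^{n\times n}$ be symmetric positive semidefinite, and let $0\le\gamma<1$. Consider $$x_{k+1}=Ax_k+Bu_k+(Cx_k+Du_k)d_k+w_k,\qquad k=0,1,2,\dots,$$ where $x_0\sim N(0,X_0)$, $d_k\sim N(0,1)$, $w_k\sim N(0,W)$ and $x_0,d_0,w_0,d_1,w_1,\dots$ are mutually independent. A control policy $u$ chooses $u_k$ as a measurable function of $x_0,\dots,x_k$. It is called admissible if there is a positive semidefinite matrix $X$ such that, for every covariance $X_0$ of the initial state, all second moments $\mathrm E(x_kx_k^\top)$ are finite and $\mathrm E(x_kx_k^\top)\to X$ as $k\to\infty$. The cost of a policy is $$V_u(x_0)=\mathrm E\Big(\sum_{k=0}^\infty\gamma^k\,(x_k^\top Qx_k+u_k^\top Ru_k)\Big)\in[0,\infty].$$ Assume that some linear policy $u=Lx$ is admissible. Then the stochastic algebraic Riccati equation $$P=Q+\gamma A^\top PA+\gamma C^\top PC-(\gamma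 A^\top PB+\gamma C^\top PD)(R+\gamma B^\top PB+\gamma D^\top PD)^{-1}(\gamma B^\top PA+\gamma D^\top PC)$$ has a positive definite solution $P^*$, it is the only positive semidefinite solution, $R+\gamma B^\top P^*B+\gamma D^\top P^*D$ is positive definite, and with $$L^*=-(R+\gamma B^\top P^*B+\gamma D^\top P^*D)^{-1}(\gamma B^\top P^*A+\gamma D^\top P^*C)$$ the policy $u^*=L^*x$ is optimal: its cost is finite, it is not larger than the cost of any policy, and it equals the infimum of the costs of the admissible policies; in particular, if $u^*$ is itself admissible, then it attains the minimum of the cost over the admissible policies. Moreover, any policy with the same cost as $u^*$ satisfies $u_k=L^*x_k$ almost surely for every $k$ (only for $k=0$ if $\gamma=0$). -/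

import Mathlib

open MeasureTheory ProbabilityTheory Filter Topology
open scoped Matrix ENNReal

namespace StochLQR

/-- A (non-anticipative, measurable) state-feedback control policy: at time `k` the control is a
measurable function of the states `x_0, …, x_k` observed so far. -/
structure Policy (n m : ℕ) where
  act : (k : ℕ) → (Fin (k + 1) → Fin n → ℝ) → Fin m → ℝ
  measurable_act : ∀ k, Measurable (act k)

/-- The stationary linear policy `u = L x`. -/
def Policy.linear {n m : ℕ} (L : Matrix (Fin m) (Fin n) ℝ) : Policy n m where
  act k h := L *ᵥ h (Fin.last k)
  measurable_act k := by
    have hL : Continuous fun x : Fin n → ℝ => L *ᵥ x :=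
      Continuous.matrix_mulVec continuous_const continuous_id
    exact hL.measurable.comp (measurable_pi_apply _)

section Dynamics

variable {n m : ℕ} (A : Matrix (Fin n) (Fin n) ℝ) (B : Matrix (Fin n) (Fin m) ℝ)
  (C : Matrix (Fin n) (Fin n) ℝ) (D : Matrix (Fin n) (Fin m) ℝ) (π : Policy n m)
  (ξ : Fin n → ℝ) (d : ℕ → ℝ) (w : ℕ → Fin n → ℝ)

/-- The states `(x_0, …, x_k)` of `x_{k+1} = A x_k + B u_k + (C x_k + D u_k) d_k + w_k`
started at `x_0 = ξ`, driven by the noise samples `d`, `w` and controlled by the policy `π`. -/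
def history : (k : ℕ) → Fin (k + 1) → Fin n → ℝ
  | 0 => fun _ => ξ
  | k + 1 =>
    Fin.snoc (α := fun _ => Fin n → ℝ) (history k)
      (A *ᵥ history k (Fin.last k) + B *ᵥ π.act k (history k)
        + d k • (C *ᵥ history k (Fin.last k) + D *ᵥ π.act k (history k)) + w k)

/-- The state `x_k`. -/
def state (k : ℕ) : Fin n → ℝ := history A B C D π ξ d w k (Fin.last k)

/-- The control `u_k`. -/
def input (k : ℕ) : Fin m → ℝ := π.act k (history A B C D π ξ d w k)

theorem state_zero : state A B C D π ξ d w 0 = ξ := rfl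

theorem state_succ (k : ℕ) :
    state A B C D π ξ d w (k + 1) =
      A *ᵥ state A B C D π ξ d w k + B *ᵥ input A B C D π ξ d w k
        + d k • (C *ᵥ state A B C D π ξ d w k + D *ᵥ input A B C D π ξ d w k) + w k := by
  simp [state, input, history]

theorem input_linear (L : Matrix (Fin m) (Fin n) ℝ) (k : ℕ) :
    input A B C D (Policy.linear L) ξ d w k = L *ᵥ state A B C D (Policy.linear L) ξ d w k := rfl

end Dynamics

/-- The random data of the system on a probability space: the initial state `x0 ∼ N(0, X0)`, the
multiplicative noises `d k ∼ N(0, 1)` and the additive noises `w k ∼ N(0, W)`, all independent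
(the three independence clauses together say that `x0, d 0, w 0, d 1, w 1, …` are mutually
independent). -/
structure IsNoise {n : ℕ} (X0 W : Matrix (Fin n) (Fin n) ℝ) {Ω : Type*} [MeasurableSpace Ω]
    (P : Measure Ω) (x0 : Ω → Fin n → ℝ) (d : ℕ → Ω → ℝ) (w : ℕ → Ω → Fin n → ℝ) : Prop where
  isProbabilityMeasure : IsProbabilityMeasure P
  measurable_init : Measurable x0
  measurable_mul : ∀ k, Measurable (d k)
  measurable_add : ∀ k, Measurable (w k)
  law_init : P.map (fun ω => WithLp.toLp 2 (x0 ω)) = multivariateGaussian 0 X0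
  law_mul : ∀ k, P.map (d k) = gaussianReal 0 1
  law_add : ∀ k, P.map (fun ω => WithLp.toLp 2 (w k ω)) = multivariateGaussian 0 W
  indep_mul_add : ∀ k, IndepFun (d k) (w k) P
  indep_time : iIndepFun (fun k ω => (d k ω, w k ω)) P
  indep_init : IndepFun x0 (fun ω k => (d k ω, w k ω)) P

section Problem

variable {n m : ℕ} (A : Matrix (Fin n) (Fin n) ℝ) (B : Matrix (Fin n) (Fin m) ℝ)
  (C : Matrix (Fin n) (Fin n) ℝ) (D : Matrix (Fin n) (Fin m) ℝ)

/-- Admissibility: the closed loop is asymptotically square stationary, i.e. the second moments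
`E (x_k x_kᵀ)` are finite and converge to one and the same positive semidefinite matrix `X`,
whatever the covariance `X0` of the initial state is (on whichever probability space the initial
state and the noises are realized). -/
def IsAdmissible (W : Matrix (Fin n) (Fin n) ℝ) (π : Policy n m) : Prop :=
  ∃ X : Matrix (Fin n) (Fin n) ℝ, X.PosSemidef ∧
    ∀ X0 : Matrix (Fin n) (Fin n) ℝ, X0.PosSemidef →
    ∀ (Ω : Type) [MeasurableSpace Ω] (P : Measure Ω) (x0 : Ω → Fin n → ℝ) (d : ℕ → Ω → ℝ)
      (w : ℕ → Ω → Fin n → ℝ), IsNoise X0 W P x0 d w →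
      (∀ k i, MemLp (fun ω => state A B C D π (x0 ω) (d · ω) (w · ω) k i) 2 P) ∧
      Tendsto (fun k => (Matrix.of fun i j =>
          ∫ ω, state A B C D π (x0 ω) (d · ω) (w · ω) k i *
            state A B C D π (x0 ω) (d · ω) (w · ω) k j ∂P : Matrix (Fin n) (Fin n) ℝ))
        atTop (𝓝 X)

/-- The discounted cost `V(x_0) = E (∑ γ^k (x_kᵀ Q x_k + u_kᵀ R u_k))`, with values in `[0, ∞]`
(the one step cost is nonnegative for positive semidefinite `Q`, `R`). -/
noncomputable def cost (Q : Matrix (Fin n) (Fin n) ℝ) (R : Matrix (Fin m) (Fin m) ℝ) (γ : ℝ)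
    {Ω : Type*} [MeasurableSpace Ω] (P : Measure Ω) (x0 : Ω → Fin n → ℝ) (d : ℕ → Ω → ℝ)
    (w : ℕ → Ω → Fin n → ℝ) (π : Policy n m) : ℝ≥0∞ :=
  ∫⁻ ω, ∑' k : ℕ, ENNReal.ofReal (γ ^ k *
    (state A B C D π (x0 ω) (d · ω) (w · ω) k ⬝ᵥ Q *ᵥ state A B C D π (x0 ω) (d · ω) (w · ω) k
      + input A B C D π (x0 ω) (d · ω) (w · ω) k ⬝ᵥ
          R *ᵥ input A B C D π (x0 ω) (d · ω) (w · ω) k)) ∂P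

/-- The matrix `R + γ Bᵀ P B + γ Dᵀ P D`. -/
def weight (R : Matrix (Fin m) (Fin m) ℝ) (γ : ℝ) (P : Matrix (Fin n) (Fin n) ℝ) :
    Matrix (Fin m) (Fin m) ℝ :=
  R + γ • (Bᵀ * P * B) + γ • (Dᵀ * P * D)

/-- The gain `-(R + γ Bᵀ P B + γ Dᵀ P D)⁻¹ (γ Bᵀ P A + γ Dᵀ P C)`. -/
noncomputable def gain (R : Matrix (Fin m) (Fin m) ℝ) (γ : ℝ) (P : Matrix (Fin n) (Fin n) ℝ) :
    Matrix (Fin m) (Fin n) ℝ :=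
  -((weight B D R γ P)⁻¹ * (γ • (Bᵀ * P * A) + γ • (Dᵀ * P * C)))

/-- The stochastic algebraic Riccati equation. -/
def SARE (Q : Matrix (Fin n) (Fin n) ℝ) (R : Matrix (Fin m) (Fin m) ℝ) (γ : ℝ)
    (P : Matrix (Fin n) (Fin n) ℝ) : Prop :=
  P = Q + γ • (Aᵀ * P * A) + γ • (Cᵀ * P * C)
    - (γ • (Aᵀ * P * B) + γ • (Cᵀ * P * D)) * (weight B D R γ P)⁻¹
      * (γ • (Bᵀ * P * A) + γ • (Dᵀ * P * C))

end Problem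

end StochLQR

/-! Dynamic programming with a quadratic value function. For positive semidefinite `S`, completing
the square in `u` (`stageCost_add_nextForm`) splits stage cost plus discounted next value into the
form of `riccatiMap S` at `x` and a gap that is positive unless `u` is the gain applied to `x`. Thus
`riccatiMap` is a pointwise minimum over controls, and in particular monotone.

Existence: the second moments under an admissible feedback converge, so for `γ < 1` its discounted
cost has a finite matrix `S` (`exists_lyapunov`). The iterates of `riccatiMap` from `0` increase,
stay below `S`, and converge to a positive definite fixed point (`exists_riccatiMap_eq`). Uniqueness
compares two fixed points along the closed loop of one of them (`le_of_riccatiMap_eq`).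

Optimality: since the noise at time `k` is independent of the history, the completed square at the
fixed point `P` becomes an identity between expectations in `[0, ∞]` (`expStageCost_step`), which
telescopes. If the cost is finite, `Q > 0` forces the discounted remainder to `0`, so the cost is a
constant independent of the policy plus the discounted sum of expected gaps (`cost_eq_add_gap`).
Minimality and almost sure uniqueness follow.

The optimal feedback need not be admissible, because discounting tolerates growing moments. The
infimum is approached by using it for `N` steps and an admissible feedback afterwards; the extra
cost tends to `0` (`isAdmissible_switch`, `cost_switch_le`). -/

namespace StochLQR

/-! ### Real quadratic forms: order, domination, monotone limits -/

section QuadraticForms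

variable {n m : ℕ}

theorem dotProduct_transpose_mul_mul_mulVec {p q r s : ℕ} (M : Matrix (Fin p) (Fin r) ℝ)
    (S : Matrix (Fin p) (Fin q) ℝ) (N : Matrix (Fin q) (Fin s) ℝ) (x : Fin r → ℝ)
    (y : Fin s → ℝ) : x ⬝ᵥ (Mᵀ * S * N) *ᵥ y = (M *ᵥ x) ⬝ᵥ S *ᵥ (N *ᵥ y) := by
  rw [Matrix.mul_assoc, ← Matrix.mulVec_mulVec, ← Matrix.mulVec_mulVec, Matrix.dotProduct_mulVec,
    Matrix.vecMul_transpose]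

theorem dotProduct_mulVec_comm {S : Matrix (Fin n) (Fin n) ℝ} (hS : Sᵀ = S) (x y : Fin n → ℝ) :
    x ⬝ᵥ S *ᵥ y = y ⬝ᵥ S *ᵥ x := by
  rw [Matrix.dotProduct_mulVec, ← Matrix.mulVec_transpose, hS, dotProduct_comm]

theorem posSemidef_iff_real {S : Matrix (Fin n) (Fin n) ℝ} :
    S.PosSemidef ↔ Sᵀ = S ∧ ∀ x : Fin n → ℝ, 0 ≤ x ⬝ᵥ S *ᵥ x := by
  rw [Matrix.posSemidef_iff_dotProduct_mulVec]
  simp [Matrix.IsHermitian]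

theorem posDef_iff_real {S : Matrix (Fin n) (Fin n) ℝ} :
    S.PosDef ↔ Sᵀ = S ∧ ∀ x : Fin n → ℝ, x ≠ 0 → 0 < x ⬝ᵥ S *ᵥ x := by
  rw [Matrix.posDef_iff_dotProduct_mulVec]
  simp [Matrix.IsHermitian]

theorem eq_of_dotProduct_mulVec_eq {S T : Matrix (Fin n) (Fin n) ℝ} (hS : Sᵀ = S) (hT : Tᵀ = T)
    (h : ∀ x : Fin n → ℝ, x ⬝ᵥ S *ᵥ x = x ⬝ᵥ T *ᵥ x) : S = T := by
  have key : ∀ x y : Fin n → ℝ, x ⬝ᵥ S *ᵥ y = x ⬝ᵥ T *ᵥ y := by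
    intro x y
    have h1 := h (x + y)
    simp only [Matrix.mulVec_add, dotProduct_add, add_dotProduct] at h1
    linarith [h x, h y, dotProduct_mulVec_comm hS x y, dotProduct_mulVec_comm hT x y]
  ext i j
  simpa using key (Pi.single i 1) (Pi.single j 1)

/-- A positive definite form dominates every form up to a constant. -/
theorem exists_dotProduct_mulVec_le {S T : Matrix (Fin n) (Fin n) ℝ} (hT : T.PosDef) :
    ∃ c : ℝ, 0 < c ∧ ∀ x : Fin n → ℝ, x ⬝ᵥ S *ᵥ x ≤ c * (x ⬝ᵥ T *ᵥ x) := by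
  have hcont : ∀ M : Matrix (Fin n) (Fin n) ℝ, Continuous fun x : Fin n → ℝ => x ⬝ᵥ M *ᵥ x :=
    fun M => continuous_id.dotProduct (continuous_const.matrix_mulVec continuous_id)
  have hcpt : IsCompact (Metric.sphere (0 : Fin n → ℝ) 1) := isCompact_sphere _ _
  rcases (Metric.sphere (0 : Fin n → ℝ) 1).eq_empty_or_nonempty with he | hne
  · refine ⟨1, one_pos, fun x => ?_⟩
    have hx : x = 0 := by
      by_contra hx
      have : ‖x‖⁻¹ • x ∈ Metric.sphere (0 : Fin n → ℝ) 1 := by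
        simp [norm_smul, norm_ne_zero_iff.mpr hx]
      simp [he] at this
    simp [hx]
  obtain ⟨a, ha, hmin⟩ := hcpt.exists_isMinOn hne (hcont T).continuousOn
  obtain ⟨b, hb, hmax⟩ := hcpt.exists_isMaxOn hne (hcont S).continuousOn
  have ha0 : a ≠ 0 := by
    rintro rfl
    simp at ha
  have hpos := (posDef_iff_real.1 hT).2 a ha0
  set l := a ⬝ᵥ T *ᵥ a
  set M := b ⬝ᵥ S *ᵥ b
  refine ⟨(|M| + 1) / l, by positivity, fun x => ?_⟩
  rcases eq_or_ne x 0 with rfl | hx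
  · simp
  have hxn : 0 < ‖x‖ := norm_pos_iff.mpr hx
  have hmem : ‖x‖⁻¹ • x ∈ Metric.sphere (0 : Fin n → ℝ) 1 := by
    simp [norm_smul, hxn.ne']
  have h1 : l ≤ _ := hmin hmem
  have h2 : _ ≤ M := hmax hmem
  have hx' : ∀ N : Matrix (Fin n) (Fin n) ℝ,
      x ⬝ᵥ N *ᵥ x = ‖x‖ ^ 2 * ((‖x‖⁻¹ • x) ⬝ᵥ N *ᵥ (‖x‖⁻¹ • x)) := by
    intro N
    simp only [Matrix.mulVec_smul, dotProduct_smul, smul_dotProduct, smul_eq_mul]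
    field_simp
  rw [hx' S, hx' T, mul_left_comm]
  refine mul_le_mul_of_nonneg_left ?_ (by positivity)
  calc _ ≤ |M| + 1 := by linarith [le_abs_self M]
    _ = (|M| + 1) / l * l := by field_simp
    _ ≤ _ := by gcongr

/-- Factoring `S = Nᴴ * N` and cycling the trace turns the product into the congruence `N * T * Nᴴ`.
-/
theorem trace_mul_nonneg {S T : Matrix (Fin n) (Fin n) ℝ} (hS : S.PosSemidef)
    (hT : T.PosSemidef) : 0 ≤ (S * T).trace := by
  obtain ⟨N, rfl⟩ : ∃ N : Matrix (Fin n) (Fin n) ℝ, S = Nᴴ * N := by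
    open scoped MatrixOrder in
    exact CStarAlgebra.nonneg_iff_eq_star_mul_self.1 hS.nonneg
  rw [Matrix.mul_assoc, Matrix.trace_mul_comm]
  exact (hT.mul_mul_conjTranspose_same N).trace_nonneg

theorem trace_mul_vecMulVec (S : Matrix (Fin n) (Fin n) ℝ) (x : Fin n → ℝ) :
    (S * Matrix.vecMulVec x x).trace = x ⬝ᵥ S *ᵥ x := by
  rw [Matrix.mul_vecMulVec, Matrix.trace_vecMulVec, dotProduct_comm]

theorem posSemidef_vecMulVec (x : Fin n → ℝ) : (Matrix.vecMulVec x x).PosSemidef := by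
  simpa using Matrix.posSemidef_vecMulVec_self_star x

/-- A sequence of symmetric matrices whose quadratic forms are nondecreasing and bounded above
converges. -/
theorem exists_tendsto_of_monotone {S : ℕ → Matrix (Fin n) (Fin n) ℝ} (hS : ∀ k, (S k)ᵀ = S k)
    (hmono : ∀ k (x : Fin n → ℝ), x ⬝ᵥ S k *ᵥ x ≤ x ⬝ᵥ S (k + 1) *ᵥ x)
    (hbdd : ∀ x : Fin n → ℝ, ∃ b, ∀ k, x ⬝ᵥ S k *ᵥ x ≤ b) :
    ∃ T, Tendsto S atTop (𝓝 T) := by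
  have hq : ∀ x : Fin n → ℝ, ∃ l, Tendsto (fun k => x ⬝ᵥ S k *ᵥ x) atTop (𝓝 l) := by
    intro x
    obtain ⟨b, hb⟩ := hbdd x
    exact ⟨_, tendsto_atTop_ciSup (monotone_nat_of_le_succ fun k => hmono k x)
      ⟨b, by rintro _ ⟨k, rfl⟩; exact hb k⟩⟩
  choose l hl using hq
  let e : Fin n → Fin n → ℝ := fun i => Pi.single i 1
  -- Polarization recovers the limit entries from the limits of the forms at `e i + e j`, `e i` and
  -- `e j`.
  refine ⟨Matrix.of fun i j => (l (e i + e j) - l (e i) - l (e j)) / 2, ?_⟩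
  refine tendsto_pi_nhds.2 fun i => tendsto_pi_nhds.2 fun j => ?_
  have h := (((hl (e i + e j)).sub (hl (e i))).sub (hl (e j))).div_const 2
  refine h.congr fun k => ?_
  have h1 : e i ⬝ᵥ S k *ᵥ e j = S k i j := by simp [e]
  have h2 := dotProduct_mulVec_comm (hS k) (e i) (e j)
  simp only [Matrix.mulVec_add, dotProduct_add, add_dotProduct]
  linarith

theorem tendsto_dotProduct_mulVec {S : ℕ → Matrix (Fin n) (Fin n) ℝ}
    {T : Matrix (Fin n) (Fin n) ℝ} (h : Tendsto S atTop (𝓝 T)) (x : Fin n → ℝ) :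
    Tendsto (fun k => x ⬝ᵥ S k *ᵥ x) atTop (𝓝 (x ⬝ᵥ T *ᵥ x)) := by
  have hc : Continuous fun M : Matrix (Fin n) (Fin n) ℝ => x ⬝ᵥ M *ᵥ x :=
    continuous_const.dotProduct (continuous_id.matrix_mulVec continuous_const)
  exact (hc.tendsto T).comp h

theorem posSemidef_of_tendsto {S : ℕ → Matrix (Fin n) (Fin n) ℝ} {T : Matrix (Fin n) (Fin n) ℝ}
    (h : Tendsto S atTop (𝓝 T)) (hS : ∀ k, (S k).PosSemidef) : T.PosSemidef := by
  refine posSemidef_iff_real.2 ⟨?_, fun x => ?_⟩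
  · have h1 : Tendsto (fun k => (S k)ᵀ) atTop (𝓝 Tᵀ) :=
      (continuous_id.matrix_transpose.tendsto T).comp h
    simp_rw [fun k => (posSemidef_iff_real.1 (hS k)).1] at h1
    exact tendsto_nhds_unique h1 h
  · exact ge_of_tendsto' (tendsto_dotProduct_mulVec h x) fun k => (posSemidef_iff_real.1 (hS k)).2 x

end QuadraticForms

/-! ### The Riccati operator and its fixed points -/

section Riccati

variable {n m : ℕ} (A : Matrix (Fin n) (Fin n) ℝ) (B : Matrix (Fin n) (Fin m) ℝ)
  (C : Matrix (Fin n) (Fin n) ℝ) (D : Matrix (Fin n) (Fin m) ℝ)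
  (Q : Matrix (Fin n) (Fin n) ℝ) (R : Matrix (Fin m) (Fin m) ℝ) (γ : ℝ)

/-- The part `(A x + B u)ᵀ S (A x + B u) + (C x + D u)ᵀ S (C x + D u)` of the expectation of
`x_{k+1}ᵀ S x_{k+1}` given `x_k = x` and `u_k = u`. -/
def nextForm (S : Matrix (Fin n) (Fin n) ℝ) (x : Fin n → ℝ) (u : Fin m → ℝ) : ℝ :=
  (A *ᵥ x + B *ᵥ u) ⬝ᵥ S *ᵥ (A *ᵥ x + B *ᵥ u) + (C *ᵥ x + D *ᵥ u) ⬝ᵥ S *ᵥ (C *ᵥ x + D *ᵥ u)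

/-- The one step cost `xᵀ Q x + uᵀ R u`. -/
def stageCost (x : Fin n → ℝ) (u : Fin m → ℝ) : ℝ := x ⬝ᵥ Q *ᵥ x + u ⬝ᵥ R *ᵥ u

/-- The right-hand side of the stochastic algebraic Riccati equation. -/
noncomputable def riccatiMap (S : Matrix (Fin n) (Fin n) ℝ) : Matrix (Fin n) (Fin n) ℝ :=
  Q + γ • (Aᵀ * S * A) + γ • (Cᵀ * S * C)
    - (γ • (Aᵀ * S * B) + γ • (Cᵀ * S * D)) * (weight B D R γ S)⁻¹
      * (γ • (Bᵀ * S * A) + γ • (Dᵀ * S * C))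

variable {A B C D Q R γ}

theorem nextForm_nonneg {S : Matrix (Fin n) (Fin n) ℝ} (hS : S.PosSemidef) (x : Fin n → ℝ)
    (u : Fin m → ℝ) : 0 ≤ nextForm A B C D S x u :=
  add_nonneg ((posSemidef_iff_real.1 hS).2 _) ((posSemidef_iff_real.1 hS).2 _)

theorem nextForm_mono {S T : Matrix (Fin n) (Fin n) ℝ}
    (h : ∀ x : Fin n → ℝ, x ⬝ᵥ S *ᵥ x ≤ x ⬝ᵥ T *ᵥ x) (x : Fin n → ℝ) (u : Fin m → ℝ) :
    nextForm A B C D S x u ≤ nextForm A B C D T x u :=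
  add_le_add (h _) (h _)

theorem dotProduct_mulVec_le_stageCost (hR : R.PosDef) (x : Fin n → ℝ) (u : Fin m → ℝ) :
    x ⬝ᵥ Q *ᵥ x ≤ stageCost Q R x u :=
  le_add_of_nonneg_right ((posSemidef_iff_real.1 hR.posSemidef).2 u)

theorem stageCost_nonneg (hQ : Q.PosDef) (hR : R.PosDef) (x : Fin n → ℝ) (u : Fin m → ℝ) :
    0 ≤ stageCost Q R x u :=
  ((posSemidef_iff_real.1 hQ.posSemidef).2 x).trans (dotProduct_mulVec_le_stageCost hR x u)

theorem weight_posDef (hR : R.PosDef) (hγ : 0 ≤ γ) {S : Matrix (Fin n) (Fin n) ℝ}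
    (hS : S.PosSemidef) : (weight B D R γ S).PosDef := by
  have h (M : Matrix (Fin n) (Fin m) ℝ) : (γ • (Mᵀ * S * M)).PosSemidef := by
    simpa using (hS.conjTranspose_mul_mul_same M).smul hγ
  exact (hR.add_posSemidef (h B)).add_posSemidef (h D)

/-- Completion of squares for the one step dynamic programming problem. -/
theorem stageCost_add_nextForm (hR : R.PosDef) (hγ : 0 ≤ γ) {S : Matrix (Fin n) (Fin n) ℝ}
    (hS : S.PosSemidef) (x : Fin n → ℝ) (u : Fin m → ℝ) :
    stageCost Q R x u + γ * nextForm A B C D S x u =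
      x ⬝ᵥ riccatiMap A B C D Q R γ S *ᵥ x
        + (u - gain A B C D R γ S *ᵥ x) ⬝ᵥ
          weight B D R γ S *ᵥ (u - gain A B C D R γ S *ᵥ x) := by
  have hH := weight_posDef (B := B) (D := D) hR hγ hS
  have hHt := (posDef_iff_real.1 hH).1
  have hSt := (posSemidef_iff_real.1 hS).1
  have hdet : IsUnit (weight B D R γ S).det := hH.det_pos.ne'.isUnit
  set G : Matrix (Fin m) (Fin n) ℝ := γ • (Bᵀ * S * A) + γ • (Dᵀ * S * C) with hG
  have hGt : γ • (Aᵀ * S * B) + γ • (Cᵀ * S * D) = Gᵀ := by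
    simp [hG, Matrix.transpose_mul, hSt, Matrix.mul_assoc]
  set v := gain A B C D R γ S *ᵥ x with hv
  have hHv : weight B D R γ S *ᵥ v = -(G *ᵥ x) := by
    rw [hv, gain, Matrix.neg_mulVec, Matrix.mulVec_neg, Matrix.mulVec_mulVec, ← Matrix.mul_assoc,
      Matrix.mul_nonsing_inv _ hdet, Matrix.one_mul]
  have hric : x ⬝ᵥ (Gᵀ * (weight B D R γ S)⁻¹ * G) *ᵥ x = -((G *ᵥ x) ⬝ᵥ v) := by
    rw [dotProduct_transpose_mul_mul_mulVec, hv, gain, Matrix.neg_mulVec, dotProduct_neg, neg_neg,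
      Matrix.mulVec_mulVec]
  have hsq : (u - v) ⬝ᵥ weight B D R γ S *ᵥ (u - v) =
      u ⬝ᵥ weight B D R γ S *ᵥ u + 2 * (u ⬝ᵥ G *ᵥ x) - (G *ᵥ x) ⬝ᵥ v := by
    have h1 := dotProduct_mulVec_comm hHt v u
    simp only [Matrix.mulVec_sub, dotProduct_sub, sub_dotProduct, h1, hHv, dotProduct_neg]
    rw [dotProduct_comm v]
    ring
  have hGu : u ⬝ᵥ G *ᵥ x =
      γ * ((B *ᵥ u) ⬝ᵥ S *ᵥ (A *ᵥ x)) + γ * ((D *ᵥ u) ⬝ᵥ S *ᵥ (C *ᵥ x)) := by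
    simp only [hG, Matrix.add_mulVec, Matrix.smul_mulVec, dotProduct_add, dotProduct_smul,
      dotProduct_transpose_mul_mul_mulVec, smul_eq_mul]
  rw [hsq, hGu, riccatiMap, hGt, ← hG, Matrix.sub_mulVec, dotProduct_sub, hric]
  simp only [Matrix.add_mulVec, Matrix.smul_mulVec, dotProduct_add, dotProduct_smul, weight,
    dotProduct_transpose_mul_mul_mulVec, nextForm, stageCost, Matrix.mulVec_add, add_dotProduct,
    smul_eq_mul]
  rw [dotProduct_mulVec_comm hSt (A *ᵥ x) (B *ᵥ u), dotProduct_mulVec_comm hSt (C *ᵥ x) (D *ᵥ u)]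
  ring

/-- Dropping the nonnegative square gives the lower bound for every control; `riccatiMap_eq` says
the gain attains it. The order properties of `riccatiMap` below rest on this variational
description, not on the formula with the inverse. -/
theorem riccatiMap_le (hR : R.PosDef) (hγ : 0 ≤ γ) {S : Matrix (Fin n) (Fin n) ℝ}
    (hS : S.PosSemidef) (x : Fin n → ℝ) (u : Fin m → ℝ) :
    x ⬝ᵥ riccatiMap A B C D Q R γ S *ᵥ x ≤ stageCost Q R x u + γ * nextForm A B C D S x u := by
  rw [stageCost_add_nextForm hR hγ hS]
  exact le_add_of_nonneg_right
    ((posSemidef_iff_real.1 (weight_posDef hR hγ hS).posSemidef).2 _)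

theorem riccatiMap_eq (hR : R.PosDef) (hγ : 0 ≤ γ) {S : Matrix (Fin n) (Fin n) ℝ}
    (hS : S.PosSemidef) (x : Fin n → ℝ) :
    x ⬝ᵥ riccatiMap A B C D Q R γ S *ᵥ x = stageCost Q R x (gain A B C D R γ S *ᵥ x)
      + γ * nextForm A B C D S x (gain A B C D R γ S *ᵥ x) := by
  rw [stageCost_add_nextForm hR hγ hS]
  simp

theorem le_riccatiMap (hR : R.PosDef) (hγ : 0 ≤ γ) {S : Matrix (Fin n) (Fin n) ℝ}
    (hS : S.PosSemidef) (x : Fin n → ℝ) :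
    x ⬝ᵥ Q *ᵥ x ≤ x ⬝ᵥ riccatiMap A B C D Q R γ S *ᵥ x := by
  rw [riccatiMap_eq hR hγ hS]
  exact (dotProduct_mulVec_le_stageCost hR _ _).trans
    (le_add_of_nonneg_right (mul_nonneg hγ (nextForm_nonneg hS _ _)))

theorem riccatiMap_posDef (hQ : Q.PosDef) (hR : R.PosDef) (hγ : 0 ≤ γ)
    {S : Matrix (Fin n) (Fin n) ℝ} (hS : S.PosSemidef) :
    (riccatiMap A B C D Q R γ S).PosDef := by
  refine posDef_iff_real.2 ⟨?_, fun x hx =>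
    ((posDef_iff_real.1 hQ).2 x hx).trans_le (le_riccatiMap hR hγ hS x)⟩
  have hSt := (posSemidef_iff_real.1 hS).1
  have hQt := (posDef_iff_real.1 hQ).1
  have hHt := (posDef_iff_real.1 (weight_posDef (B := B) (D := D) hR hγ hS)).1
  simp [riccatiMap, Matrix.transpose_mul, Matrix.transpose_nonsing_inv, hSt, hQt, hHt,
    Matrix.mul_assoc]

/-- The minimizing control for `T` is a competitor in the minimum that defines the value for `S`. -/
theorem riccatiMap_mono (hR : R.PosDef) (hγ : 0 ≤ γ) {S T : Matrix (Fin n) (Fin n) ℝ}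
    (hS : S.PosSemidef) (hT : T.PosSemidef)
    (h : ∀ x : Fin n → ℝ, x ⬝ᵥ S *ᵥ x ≤ x ⬝ᵥ T *ᵥ x) (x : Fin n → ℝ) :
    x ⬝ᵥ riccatiMap A B C D Q R γ S *ᵥ x ≤ x ⬝ᵥ riccatiMap A B C D Q R γ T *ᵥ x := by
  rw [riccatiMap_eq hR hγ hT]
  refine (riccatiMap_le hR hγ hS x (gain A B C D R γ T *ᵥ x)).trans ?_
  gcongr
  exact nextForm_mono h _ _

theorem continuousAt_riccatiMap (hR : R.PosDef) (hγ : 0 ≤ γ) {S : Matrix (Fin n) (Fin n) ℝ}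
    (hS : S.PosSemidef) : ContinuousAt (riccatiMap A B C D Q R γ) S := by
  have hdet : (weight B D R γ S).det ≠ 0 := (weight_posDef hR hγ hS).det_pos.ne'
  have hw : Continuous fun S => weight B D R γ S := by
    unfold weight
    fun_prop
  have hinv : ContinuousAt (fun S => (weight B D R γ S)⁻¹) S := by
    refine ContinuousAt.comp (f := fun S => weight B D R γ S)
      (continuousAt_matrix_inv _ ?_) hw.continuousAt
    simpa [Ring.inverse_eq_inv'] using continuousAt_inv₀ hdet
  unfold riccatiMap
  have h1 : Continuous fun S : Matrix (Fin n) (Fin n) ℝ =>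
      Q + γ • (Aᵀ * S * A) + γ • (Cᵀ * S * C) := by fun_prop
  have h2 : Continuous fun S : Matrix (Fin n) (Fin n) ℝ =>
      γ • (Aᵀ * S * B) + γ • (Cᵀ * S * D) := by fun_prop
  have h3 : Continuous fun S : Matrix (Fin n) (Fin n) ℝ =>
      γ • (Bᵀ * S * A) + γ • (Dᵀ * S * C) := by fun_prop
  have hmul {p q r : ℕ} : Continuous fun M : Matrix (Fin p) (Fin q) ℝ × Matrix (Fin q) (Fin r) ℝ =>
      M.1 * M.2 := continuous_fst.matrix_mul continuous_snd
  exact h1.continuousAt.sub (hmul.continuousAt.comp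
    ((hmul.continuousAt.comp (h2.continuousAt.prodMk hinv)).prodMk h3.continuousAt))

/-- The Riccati equation has a solution as soon as the feedback gain `L` has a closed loop
Lyapunov supersolution. -/
theorem exists_riccatiMap_eq (hQ : Q.PosDef) (hR : R.PosDef) (hγ : 0 ≤ γ)
    {S : Matrix (Fin n) (Fin n) ℝ} (hS : S.PosSemidef) {L : Matrix (Fin m) (Fin n) ℝ}
    (hL : ∀ x, stageCost Q R x (L *ᵥ x) + γ * nextForm A B C D S x (L *ᵥ x) ≤ x ⬝ᵥ S *ᵥ x) :
    ∃ P, P.PosDef ∧ riccatiMap A B C D Q R γ P = P := by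
  -- Value iteration from zero terminal cost.
  let F := riccatiMap A B C D Q R γ
  have hpsd : ∀ k, (F^[k] 0).PosSemidef := by
    intro k
    induction k with
    | zero => exact Matrix.PosSemidef.zero
    | succ k ih =>
      rw [Function.iterate_succ_apply']
      exact (riccatiMap_posDef hQ hR hγ ih).posSemidef
  have hmono : ∀ k (x : Fin n → ℝ), x ⬝ᵥ F^[k] 0 *ᵥ x ≤ x ⬝ᵥ F^[k + 1] 0 *ᵥ x := by
    intro k
    induction k with
    | zero => intro x; simpa using (posSemidef_iff_real.1 (hpsd 1)).2 x
    | succ k ih =>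
      rw [Function.iterate_succ_apply' F k, Function.iterate_succ_apply' F (k + 1)]
      exact riccatiMap_mono hR hγ (hpsd _) (hpsd _) ih
  -- `L` is one competitor at each stage, and `S` is a supersolution for it.
  have hle : ∀ k (x : Fin n → ℝ), x ⬝ᵥ F^[k] 0 *ᵥ x ≤ x ⬝ᵥ S *ᵥ x := by
    intro k
    induction k with
    | zero => intro x; simpa using (posSemidef_iff_real.1 hS).2 x
    | succ k ih =>
      intro x
      rw [Function.iterate_succ_apply']
      refine (riccatiMap_le hR hγ (hpsd k) x (L *ᵥ x)).trans (le_trans ?_ (hL x))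
      gcongr
      exact nextForm_mono ih _ _
  obtain ⟨P, hP⟩ := exists_tendsto_of_monotone (fun k => (posSemidef_iff_real.1 (hpsd k)).1) hmono
    fun x => ⟨_, fun k => hle k x⟩
  have hPpsd := posSemidef_of_tendsto hP hpsd
  have hfix : F P = P := by
    have h1 := (continuousAt_riccatiMap (A := A) (B := B) (C := C) (D := D) (Q := Q)
      hR hγ hPpsd).tendsto.comp hP
    have h2 := hP.comp (tendsto_add_atTop_nat 1)
    refine tendsto_nhds_unique h1 (h2.congr fun k => ?_)
    simp only [Function.comp_apply, Function.iterate_succ_apply', F]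
  refine ⟨P, ?_, hfix⟩
  have := riccatiMap_posDef (A := A) (B := B) (C := C) (D := D) hQ hR hγ hPpsd
  rwa [show riccatiMap A B C D Q R γ P = P from hfix] at this

/-- Along the closed loop of the gain of `T`, the equation for `T` is an equality and that for `S`
only an inequality, so `S - T` at `x` is at most `γ` times its value one step later. The form of `T`
is a Lyapunov function for this discounted loop, contracting by `ρ < 1`; iterating the bound drives
it to `0`. -/
theorem le_of_riccatiMap_eq (hQ : Q.PosDef) (hR : R.PosDef) (hγ : 0 ≤ γ)
    {S T : Matrix (Fin n) (Fin n) ℝ} (hS : S.PosSemidef) (hT : T.PosSemidef)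
    (hSF : riccatiMap A B C D Q R γ S = S) (hTF : riccatiMap A B C D Q R γ T = T)
    (x : Fin n → ℝ) : x ⬝ᵥ S *ᵥ x ≤ x ⬝ᵥ T *ᵥ x := by
  have hQ0 := (posSemidef_iff_real.1 hQ.posSemidef).2
  have hT0 := (posSemidef_iff_real.1 hT).2
  have hQT : ∀ x : Fin n → ℝ, x ⬝ᵥ Q *ᵥ x ≤ x ⬝ᵥ T *ᵥ x := by
    intro x
    have := le_riccatiMap (A := A) (B := B) (C := C) (D := D) (Q := Q) hR hγ hT x
    rwa [hTF] at this
  obtain ⟨θ, hθ, hSQ⟩ := exists_dotProduct_mulVec_le (S := S) hQ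
  obtain ⟨c, hc, hTQ⟩ := exists_dotProduct_mulVec_le (S := T) hQ
  set L := gain A B C D R γ T
  have hTeq : ∀ x, x ⬝ᵥ T *ᵥ x = stageCost Q R x (L *ᵥ x)
      + γ * nextForm A B C D T x (L *ᵥ x) := by
    intro x
    have := riccatiMap_eq (A := A) (B := B) (C := C) (D := D) (Q := Q) hR hγ hT x
    rwa [hTF] at this
  have hSle : ∀ x, x ⬝ᵥ S *ᵥ x ≤ stageCost Q R x (L *ᵥ x)
      + γ * nextForm A B C D S x (L *ᵥ x) := by
    intro x
    have := riccatiMap_le (A := A) (B := B) (C := C) (D := D) (Q := Q) hR hγ hS x (L *ᵥ x)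
    rwa [hSF] at this
  -- From `T ≤ c Q`, the stage cost uses up at least the fraction `1 / (1 + c)` of the form of `T`,
  -- leaving at most `ρ`. Taking `1 + c` rather than `c` makes `0 ≤ ρ < 1` immediate.
  set ρ := c / (1 + c) with hρ
  have hρ0 : 0 ≤ ρ := by positivity
  have hρ1 : ρ < 1 := by rw [hρ, div_lt_one (by positivity)]; linarith
  have key : ∀ (k : ℕ) (x : Fin n → ℝ),
      x ⬝ᵥ S *ᵥ x - x ⬝ᵥ T *ᵥ x ≤ θ * ρ ^ k * (x ⬝ᵥ T *ᵥ x) := by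
    intro k
    induction k with
    | zero =>
      intro x
      have := mul_le_mul_of_nonneg_left (hQT x) hθ.le
      linarith [hSQ x, hT0 x]
    | succ k ih =>
      intro x
      have h1 : nextForm A B C D S x (L *ᵥ x) - nextForm A B C D T x (L *ᵥ x) ≤
          θ * ρ ^ k * nextForm A B C D T x (L *ᵥ x) := by
        have ha := ih (A *ᵥ x + B *ᵥ (L *ᵥ x))
        have hb := ih (C *ᵥ x + D *ᵥ (L *ᵥ x))
        simp only [nextForm]
        linarith
      have h2 : γ * nextForm A B C D T x (L *ᵥ x) ≤ ρ * (x ⬝ᵥ T *ᵥ x) := by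
        have h3 := dotProduct_mulVec_le_stageCost (Q := Q) hR x (L *ᵥ x)
        have h4 : (x ⬝ᵥ T *ᵥ x) / (1 + c) ≤ x ⬝ᵥ Q *ᵥ x := by
          rw [div_le_iff₀ (by positivity)]
          linarith [hTQ x, hQ0 x]
        have h5 : ρ * (x ⬝ᵥ T *ᵥ x) = x ⬝ᵥ T *ᵥ x - (x ⬝ᵥ T *ᵥ x) / (1 + c) := by
          rw [hρ]; field_simp; ring
        linarith [hTeq x]
      calc x ⬝ᵥ S *ᵥ x - x ⬝ᵥ T *ᵥ x
          ≤ γ * (nextForm A B C D S x (L *ᵥ x) - nextForm A B C D T x (L *ᵥ x)) := by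
            linarith [hTeq x, hSle x]
        _ ≤ γ * (θ * ρ ^ k * nextForm A B C D T x (L *ᵥ x)) := by gcongr
        _ = θ * ρ ^ k * (γ * nextForm A B C D T x (L *ᵥ x)) := by ring
        _ ≤ θ * ρ ^ k * (ρ * (x ⬝ᵥ T *ᵥ x)) := by gcongr
        _ = θ * ρ ^ (k + 1) * (x ⬝ᵥ T *ᵥ x) := by ring
  have hlim : Tendsto (fun k : ℕ => θ * ρ ^ k * (x ⬝ᵥ T *ᵥ x)) atTop (𝓝 0) := by
    simpa using ((tendsto_pow_atTop_nhds_zero_of_lt_one hρ0 hρ1).const_mul θ).mul_const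
      (x ⬝ᵥ T *ᵥ x)
  linarith [ge_of_tendsto' hlim fun k => key k x]

theorem eq_of_riccatiMap_eq (hQ : Q.PosDef) (hR : R.PosDef) (hγ : 0 ≤ γ)
    {S T : Matrix (Fin n) (Fin n) ℝ} (hS : S.PosSemidef) (hT : T.PosSemidef)
    (hSF : riccatiMap A B C D Q R γ S = S) (hTF : riccatiMap A B C D Q R γ T = T) : S = T :=
  eq_of_dotProduct_mulVec_eq (posSemidef_iff_real.1 hS).1 (posSemidef_iff_real.1 hT).1 fun x =>
    (le_of_riccatiMap_eq hQ hR hγ hS hT hSF hTF x).antisymm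
      (le_of_riccatiMap_eq hQ hR hγ hT hS hTF hSF x)

end Riccati

/-! ### Moment recursion, its adjoint, and the cost matrix of a feedback -/

section Lyapunov

variable {n m : ℕ} (A : Matrix (Fin n) (Fin n) ℝ) (B : Matrix (Fin n) (Fin m) ℝ)
  (C : Matrix (Fin n) (Fin n) ℝ) (D : Matrix (Fin n) (Fin m) ℝ)
  (W : Matrix (Fin n) (Fin n) ℝ)

/-- The evolution of the second moment `E (x xᵀ)` in one step under the feedback `u = L x`. -/
def momentStep (L : Matrix (Fin m) (Fin n) ℝ) (X : Matrix (Fin n) (Fin n) ℝ) :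
    Matrix (Fin n) (Fin n) ℝ :=
  (A + B * L) * X * (A + B * L)ᵀ + (C + D * L) * X * (C + D * L)ᵀ + W

/-- The matrix of the form `x ↦ nextForm A B C D S x (L x)`. -/
def adjointStep (L : Matrix (Fin m) (Fin n) ℝ) (S : Matrix (Fin n) (Fin n) ℝ) :
    Matrix (Fin n) (Fin n) ℝ :=
  (A + B * L)ᵀ * S * (A + B * L) + (C + D * L)ᵀ * S * (C + D * L)

variable {A B C D W}

theorem momentStep_posSemidef (hW : W.PosSemidef) (L : Matrix (Fin m) (Fin n) ℝ)
    {X : Matrix (Fin n) (Fin n) ℝ} (hX : X.PosSemidef) :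
    (momentStep A B C D W L X).PosSemidef := by
  have h (M : Matrix (Fin n) (Fin n) ℝ) : (M * X * Mᵀ).PosSemidef := by
    simpa using hX.mul_mul_conjTranspose_same M
  exact ((h _).add (h _)).add hW

theorem adjointStep_posSemidef (L : Matrix (Fin m) (Fin n) ℝ)
    {S : Matrix (Fin n) (Fin n) ℝ} (hS : S.PosSemidef) :
    (adjointStep A B C D L S).PosSemidef := by
  have h (M : Matrix (Fin n) (Fin n) ℝ) : (Mᵀ * S * M).PosSemidef := by
    simpa using hS.conjTranspose_mul_mul_same M
  exact (h _).add (h _)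

theorem dotProduct_adjointStep (L : Matrix (Fin m) (Fin n) ℝ)
    (S : Matrix (Fin n) (Fin n) ℝ) (x : Fin n → ℝ) :
    x ⬝ᵥ adjointStep A B C D L S *ᵥ x = nextForm A B C D S x (L *ᵥ x) := by
  simp only [adjointStep, nextForm, Matrix.add_mulVec, dotProduct_add,
    dotProduct_transpose_mul_mul_mulVec, Matrix.mulVec_mulVec]

/-- Duality for the trace pairing: it converts bounds on second moments into bounds on cost
matrices. -/
theorem trace_mul_momentStep (L : Matrix (Fin m) (Fin n) ℝ) (S X : Matrix (Fin n) (Fin n) ℝ) :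
    (S * momentStep A B C D W L X).trace =
      (adjointStep A B C D L S * X).trace + (S * W).trace := by
  have h (M : Matrix (Fin n) (Fin n) ℝ) : (S * (M * X * Mᵀ)).trace = (Mᵀ * S * M * X).trace := by
    rw [← Matrix.mul_assoc, Matrix.trace_mul_comm]
    simp only [Matrix.mul_assoc]
  rw [momentStep, adjointStep, Matrix.mul_add, Matrix.mul_add, Matrix.trace_add,
    Matrix.trace_add, h, h, ← Matrix.trace_add, ← Matrix.add_mul]

/-- If the second moments of the closed loop converge, the discounted cost matrix of the
feedback `L` exists. -/
theorem exists_lyapunov {Q : Matrix (Fin n) (Fin n) ℝ} {R : Matrix (Fin m) (Fin m) ℝ} {γ : ℝ}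
    (hQ : Q.PosDef) (hR : R.PosDef) (hγ0 : 0 ≤ γ) (hγ1 : γ < 1) (hW : W.PosSemidef)
    (L : Matrix (Fin m) (Fin n) ℝ)
    (hL : ∀ X : Matrix (Fin n) (Fin n) ℝ, X.PosSemidef →
      ∃ Y, Tendsto (fun k => (momentStep A B C D W L)^[k] X) atTop (𝓝 Y)) :
    ∃ S, S.PosSemidef ∧ ∀ x,
      stageCost Q R x (L *ᵥ x) + γ * nextForm A B C D S x (L *ᵥ x) = x ⬝ᵥ S *ᵥ x := by
  let K := Q + Lᵀ * R * L
  have hK : K.PosSemidef := hQ.posSemidef.add (by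
    simpa using hR.posSemidef.conjTranspose_mul_mul_same L)
  have hKx : ∀ x, x ⬝ᵥ K *ᵥ x = stageCost Q R x (L *ᵥ x) := by
    intro x
    simp only [K, Matrix.add_mulVec, dotProduct_add, dotProduct_transpose_mul_mul_mulVec,
      stageCost]
  let F : Matrix (Fin n) (Fin n) ℝ → Matrix (Fin n) (Fin n) ℝ :=
    fun S => K + γ • adjointStep A B C D L S
  have hFx : ∀ S x, x ⬝ᵥ F S *ᵥ x =
      stageCost Q R x (L *ᵥ x) + γ * nextForm A B C D S x (L *ᵥ x) := by
    intro S x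
    simp only [F, Matrix.add_mulVec, Matrix.smul_mulVec, dotProduct_add, dotProduct_smul,
      smul_eq_mul, hKx, dotProduct_adjointStep]
  have hpsd : ∀ k, (F^[k] 0).PosSemidef := by
    intro k
    induction k with
    | zero => exact Matrix.PosSemidef.zero
    | succ k ih =>
      rw [Function.iterate_succ_apply']
      exact hK.add ((adjointStep_posSemidef L ih).smul hγ0)
  have hmono : ∀ k (x : Fin n → ℝ), x ⬝ᵥ F^[k] 0 *ᵥ x ≤ x ⬝ᵥ F^[k + 1] 0 *ᵥ x := by
    intro k
    induction k with
    | zero => intro x; simpa using (posSemidef_iff_real.1 (hpsd 1)).2 x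
    | succ k ih =>
      intro x
      rw [Function.iterate_succ_apply' F k, Function.iterate_succ_apply' F (k + 1), hFx, hFx]
      gcongr
      exact nextForm_mono ih _ _
  -- By duality, one step of `F` on the left is traded for one `momentStep` on `X`, so the induction
  -- needs `X` arbitrary. The constant `b / (1 - γ)` is the fixed point of `t ↦ b + γ * t`; the
  -- noise trace is nonnegative and is discarded.
  have hstep : ∀ (b : ℝ), ∀ k (X : Matrix (Fin n) (Fin n) ℝ), X.PosSemidef →
      (∀ j, (K * (momentStep A B C D W L)^[j] X).trace ≤ b) →
      (F^[k] 0 * X).trace ≤ b / (1 - γ) := by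
    intro b k
    induction k with
    | zero =>
      intro X hX hb
      simpa using div_nonneg ((trace_mul_nonneg hK hX).trans (hb 0)) (by linarith)
    | succ k ih =>
      intro X hX hb
      have h1 := ih _ (momentStep_posSemidef (A := A) (B := B) (C := C) (D := D) hW L hX)
        fun j => hb (j + 1)
      have h2 := hb 0
      rw [trace_mul_momentStep] at h1
      simp only [Function.iterate_zero, id] at h2
      have h3 := trace_mul_nonneg (hpsd k) hW
      have h4 : γ * (adjointStep A B C D L (F^[k] 0) * X).trace ≤ γ * (b / (1 - γ)) := by
        gcongr
        linarith
      rw [Function.iterate_succ_apply']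
      simp only [F, Matrix.add_mul, Matrix.trace_add, Matrix.smul_mul, Matrix.trace_smul,
        smul_eq_mul]
      have h5 : b / (1 - γ) = b + γ * (b / (1 - γ)) := by
        have : (1 - γ) ≠ 0 := by linarith
        field_simp
        ring
      simp only [F] at h4
      linarith
  have hbdd : ∀ x : Fin n → ℝ, ∃ b, ∀ k, x ⬝ᵥ F^[k] 0 *ᵥ x ≤ b := by
    intro x
    -- Starting the moments at `x xᵀ` turns traces into the form at `x`; a convergent sequence is
    -- bounded.
    obtain ⟨Y, hY⟩ := hL _ (posSemidef_vecMulVec x)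
    have hc : Continuous fun X : Matrix (Fin n) (Fin n) ℝ => (K * X).trace := by fun_prop
    obtain ⟨b, hb⟩ := ((hc.tendsto Y).comp hY).bddAbove_range
    refine ⟨b / (1 - γ), fun k => ?_⟩
    rw [← trace_mul_vecMulVec]
    exact hstep b k _ (posSemidef_vecMulVec x) fun j => hb ⟨j, rfl⟩
  obtain ⟨S, hS⟩ := exists_tendsto_of_monotone (fun k => (posSemidef_iff_real.1 (hpsd k)).1) hmono
    hbdd
  refine ⟨S, posSemidef_of_tendsto hS hpsd, fun x => ?_⟩
  have hF : Continuous F := by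
    simp only [F, adjointStep]
    fun_prop
  have hfix : F S = S := by
    refine tendsto_nhds_unique ((hF.tendsto S).comp hS)
      ((hS.comp (tendsto_add_atTop_nat 1)).congr fun k => ?_)
    simp only [Function.comp_apply, Function.iterate_succ_apply']
  rw [← hFx, hfix]

end Lyapunov

/-! ### Second moments and Gaussian laws -/

section Moments

variable {n : ℕ} {Ω : Type*} [MeasurableSpace Ω] {μ : Measure Ω}

theorem dotProduct_mulVec_eq_sum (S : Matrix (Fin n) (Fin n) ℝ) (y : Fin n → ℝ) :
    y ⬝ᵥ S *ᵥ y = ∑ i, ∑ j, S i j * (y i * y j) := by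
  simp only [dotProduct, Matrix.mulVec, Finset.mul_sum]
  exact Finset.sum_congr rfl fun i _ => Finset.sum_congr rfl fun j _ => by ring

theorem integrable_mul_of_memLp {f g : Ω → ℝ} (hf : MemLp f 2 μ) (hg : MemLp g 2 μ) :
    Integrable (fun ω => f ω * g ω) μ :=
  hf.integrable_mul hg

theorem lintegral_dotProduct_mulVec {y : Ω → Fin n → ℝ} {M S : Matrix (Fin n) (Fin n) ℝ}
    (hy : ∀ i, MemLp (fun ω => y ω i) 2 μ) (hM : ∀ i j, ∫ ω, y ω i * y ω j ∂μ = M i j)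
    (hS : S.PosSemidef) :
    ∫⁻ ω, ENNReal.ofReal (y ω ⬝ᵥ S *ᵥ y ω) ∂μ = ENNReal.ofReal (S * M).trace := by
  have hint : ∀ i j, Integrable (fun ω => S i j * (y ω i * y ω j)) μ := fun i j =>
    (integrable_mul_of_memLp (hy i) (hy j)).const_mul _
  have hMt : ∀ i j, M i j = M j i := fun i j => by
    rw [← hM, ← hM]
    simp only [mul_comm]
  simp only [dotProduct_mulVec_eq_sum]
  rw [← ofReal_integral_eq_lintegral_ofReal]
  · congr 1
    rw [integral_finsetSum _ fun i _ => integrable_finsetSum _ fun j _ => hint i j]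
    simp only [Matrix.trace, Matrix.diag, Matrix.mul_apply]
    refine Finset.sum_congr rfl fun i _ => ?_
    rw [integral_finsetSum _ fun j _ => hint i j]
    refine Finset.sum_congr rfl fun j _ => ?_
    rw [integral_const_mul, hM, hMt]
  · exact integrable_finsetSum _ fun i _ => integrable_finsetSum _ fun j _ => hint i j
  · refine Eventually.of_forall fun ω => ?_
    simp only [← dotProduct_mulVec_eq_sum]
    exact (posSemidef_iff_real.1 hS).2 _

/-- Second moments are determined by the expectations of the quadratic forms. -/
theorem memLp_and_integral_of_lintegral {y : Ω → Fin n → ℝ} {M : Matrix (Fin n) (Fin n) ℝ}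
    (hy : Measurable y) (hM : M.PosSemidef)
    (h : ∀ S : Matrix (Fin n) (Fin n) ℝ, S.PosSemidef →
      ∫⁻ ω, ENNReal.ofReal (y ω ⬝ᵥ S *ᵥ y ω) ∂μ = ENNReal.ofReal (S * M).trace) :
    (∀ i, MemLp (fun ω => y ω i) 2 μ) ∧ ∀ i j, ∫ ω, y ω i * y ω j ∂μ = M i j := by
  have hyi : ∀ i, Measurable fun ω => y ω i := fun i => (measurable_pi_apply i).comp hy
  -- Rank-one test matrices `v vᵀ` suffice: basis vectors give square integrability, sums of two
  -- give the mixed moments.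
  have hsq : ∀ v : Fin n → ℝ,
      ∫⁻ ω, ENNReal.ofReal ((v ⬝ᵥ y ω) ^ 2) ∂μ = ENNReal.ofReal (v ⬝ᵥ M *ᵥ v) := by
    intro v
    have := h _ (posSemidef_vecMulVec v)
    rw [Matrix.trace_mul_comm, trace_mul_vecMulVec] at this
    rw [← this]
    refine lintegral_congr fun ω => ?_
    rw [Matrix.vecMulVec_mulVec, op_smul_eq_smul, dotProduct_smul, dotProduct_comm (y ω), sq,
      smul_eq_mul]
  have hmeas : ∀ v : Fin n → ℝ, Measurable fun ω => v ⬝ᵥ y ω := fun v =>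
    (continuous_const.dotProduct continuous_id).measurable.comp hy
  have hmem : ∀ v : Fin n → ℝ, Integrable (fun ω => (v ⬝ᵥ y ω) ^ 2) μ := by
    intro v
    refine ⟨((hmeas v).pow_const 2).aestronglyMeasurable, ?_⟩
    rw [hasFiniteIntegral_iff_ofReal (Eventually.of_forall fun ω => sq_nonneg _), hsq]
    exact ENNReal.ofReal_lt_top
  have hint : ∀ v : Fin n → ℝ, ∫ ω, (v ⬝ᵥ y ω) ^ 2 ∂μ = v ⬝ᵥ M *ᵥ v := by
    intro v
    rw [integral_eq_lintegral_of_nonneg_ae (Eventually.of_forall fun ω => sq_nonneg _)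
      (hmem v).aestronglyMeasurable, hsq, ENNReal.toReal_ofReal ((posSemidef_iff_real.1 hM).2 v)]
  have hLp : ∀ i, MemLp (fun ω => y ω i) 2 μ := by
    intro i
    refine (memLp_two_iff_integrable_sq (hyi i).aestronglyMeasurable).2 ?_
    simpa using hmem (Pi.single i 1)
  refine ⟨hLp, fun i j => ?_⟩
  have h1 := hint (Pi.single i 1 + Pi.single j 1)
  have h2 : ∀ ω, ((Pi.single i 1 + Pi.single j 1 : Fin n → ℝ) ⬝ᵥ y ω) ^ 2 =
      y ω i ^ 2 + 2 * (y ω i * y ω j) + y ω j ^ 2 := by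
    intro ω
    simp only [add_dotProduct, single_one_dotProduct]
    ring
  simp only [h2] at h1
  rw [integral_add, integral_add, integral_const_mul] at h1
  · have h3 := hint (Pi.single i 1)
    have h4 := hint (Pi.single j 1)
    have h5 := dotProduct_mulVec_comm (posSemidef_iff_real.1 hM).1 (Pi.single i 1) (Pi.single j 1)
    simp only [Matrix.mulVec_add, add_dotProduct, dotProduct_add, single_one_dotProduct,
      Matrix.mulVec_single_one, Matrix.col_apply] at h1 h3 h4 h5
    linarith
  · exact (hLp i).integrable_sq
  · exact (integrable_mul_of_memLp (hLp i) (hLp j)).const_mul 2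
  · exact (hLp i).integrable_sq.add ((integrable_mul_of_memLp (hLp i) (hLp j)).const_mul 2)
  · exact (hLp j).integrable_sq

section Gaussian

variable {y : Ω → Fin n → ℝ} {W : Matrix (Fin n) (Fin n) ℝ}

theorem memLp_of_law (hy : Measurable y)
    (hlaw : μ.map (fun ω => WithLp.toLp 2 (y ω)) = multivariateGaussian 0 W) (i : Fin n) :
    MemLp (fun ω => y ω i) 2 μ := by
  have hm : Measurable fun ω => WithLp.toLp 2 (y ω) := (WithLp.measurable_toLp 2 _).comp hy
  have h : MemLp (id : EuclideanSpace ℝ (Fin n) → _) 2 (multivariateGaussian 0 W) :=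
    IsGaussian.memLp_two_id
  rw [← hlaw] at h
  exact ((EuclideanSpace.proj (𝕜 := ℝ) i).comp_memLp' h).comp_of_map hm.aemeasurable

theorem integral_of_law (hy : Measurable y)
    (hlaw : μ.map (fun ω => WithLp.toLp 2 (y ω)) = multivariateGaussian 0 W) (i : Fin n) :
    ∫ ω, y ω i ∂μ = 0 := by
  have hm : Measurable fun ω => WithLp.toLp 2 (y ω) := (WithLp.measurable_toLp 2 _).comp hy
  have h := (EuclideanSpace.proj (𝕜 := ℝ) i).integral_comp_comm
    (μ := multivariateGaussian 0 W) (φ := fun x => x) IsGaussian.integrable_fun_id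
  rw [integral_id_multivariateGaussian, ← hlaw, integral_map hm.aemeasurable (by fun_prop)] at h
  simpa using h

theorem integral_mul_of_law (hy : Measurable y) (hW : W.PosSemidef)
    (hlaw : μ.map (fun ω => WithLp.toLp 2 (y ω)) = multivariateGaussian 0 W) (i j : Fin n) :
    ∫ ω, y ω i * y ω j ∂μ = W i j := by
  have hm : Measurable fun ω => WithLp.toLp 2 (y ω) := (WithLp.measurable_toLp 2 _).comp hy
  have h := covariance_eval_multivariateGaussian (μ := 0) hW i j
  rw [← hlaw, covariance_map (by fun_prop) (by fun_prop) hm.aemeasurable] at h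
  rw [← h, covariance]
  have h0 := integral_of_law hy hlaw
  simp only [Function.comp_def]
  simp [h0]

end Gaussian

/-- The vectors `a`, `b` stand for the drift and the noise direction with the past frozen. Centering
kills the terms linear in the noise, and independence kills those mixing `d` and `w`. -/
theorem integral_noise_mul [IsProbabilityMeasure μ] {d : Ω → ℝ} {w : Ω → Fin n → ℝ}
    {W : Matrix (Fin n) (Fin n) ℝ}
    (hd : MemLp d 2 μ) (hd1 : ∫ ω, d ω ∂μ = 0) (hd2 : ∫ ω, d ω * d ω ∂μ = 1)
    (hw : ∀ i, MemLp (fun ω => w ω i) 2 μ) (hw1 : ∀ i, ∫ ω, w ω i ∂μ = 0)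
    (hw2 : ∀ i j, ∫ ω, w ω i * w ω j ∂μ = W i j) (hdw : IndepFun d w μ)
    (a b : Fin n → ℝ) (i j : Fin n) :
    ∫ ω, (a + d ω • b + w ω) i * (a + d ω • b + w ω) j ∂μ =
      (Matrix.vecMulVec a a + Matrix.vecMulVec b b + W) i j := by
  have hcross : ∀ i, ∫ ω, d ω * w ω i ∂μ = 0 := by
    intro i
    have : IndepFun d (fun ω => w ω i) μ := hdw.comp measurable_id (measurable_pi_apply i)
    rw [this.integral_fun_mul_eq_mul_integral hd.aestronglyMeasurable (hw i).aestronglyMeasurable,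
      hd1, zero_mul]
  have i1 := hd.integrable one_le_two
  have i2 := fun i => (hw i).integrable one_le_two
  have i3 := integrable_mul_of_memLp hd hd
  have i4 := fun i => integrable_mul_of_memLp hd (hw i)
  have i5 := fun i j => integrable_mul_of_memLp (hw i) (hw j)
  have hexp : ∀ ω, (a + d ω • b + w ω) i * (a + d ω • b + w ω) j =
      a i * a j + (a i * b j + a j * b i) * d ω + b i * b j * (d ω * d ω) + a i * w ω j
        + a j * w ω i + b i * (d ω * w ω j) + b j * (d ω * w ω i) + w ω i * w ω j := by
    intro ω
    simp only [Pi.add_apply, Pi.smul_apply, smul_eq_mul]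
    ring
  simp only [hexp]
  rw [integral_add (by fun_prop) (i5 i j), integral_add (by fun_prop) ((i4 i).const_mul _),
    integral_add (by fun_prop) ((i4 j).const_mul _), integral_add (by fun_prop) ((i2 i).const_mul _),
    integral_add (by fun_prop) ((i2 j).const_mul _), integral_add (by fun_prop) (i3.const_mul _),
    integral_add (by fun_prop) (i1.const_mul _)]
  simp only [integral_const_mul, hcross, hw1, hw2, hd1, hd2, integral_const, probReal_univ,
    Matrix.add_apply, Matrix.vecMulVec_apply]
  simp

end Moments

/-! ### Causality and measurability of the closed loop -/

section Dynamics

variable {n m : ℕ} {A : Matrix (Fin n) (Fin n) ℝ} {B : Matrix (Fin n) (Fin m) ℝ}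
  {C : Matrix (Fin n) (Fin n) ℝ} {D : Matrix (Fin n) (Fin m) ℝ}

theorem history_congr (π : Policy n m) (ξ : Fin n → ℝ) {d d' : ℕ → ℝ} {w w' : ℕ → Fin n → ℝ}
    {k : ℕ} (hd : ∀ j < k, d j = d' j) (hw : ∀ j < k, w j = w' j) :
    history A B C D π ξ d w k = history A B C D π ξ d' w' k := by
  induction k with
  | zero => rfl
  | succ k ih =>
    have := ih (fun j hj => hd j (hj.trans k.lt_succ_self))
      (fun j hj => hw j (hj.trans k.lt_succ_self))
    simp only [history, this, hd k k.lt_succ_self, hw k k.lt_succ_self]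

variable {Ω : Type*} [MeasurableSpace Ω]

theorem measurable_mulVec {p q : ℕ} (M : Matrix (Fin p) (Fin q) ℝ) {f : Ω → Fin q → ℝ}
    (hf : Measurable f) : Measurable fun ω => M *ᵥ f ω :=
  (Continuous.matrix_mulVec continuous_const continuous_id).measurable.comp hf

theorem measurable_dotProduct_mulVec {p : ℕ} (M : Matrix (Fin p) (Fin p) ℝ) {f : Ω → Fin p → ℝ}
    (hf : Measurable f) : Measurable fun ω => f ω ⬝ᵥ M *ᵥ f ω :=
  (continuous_id.dotProduct (continuous_const.matrix_mulVec continuous_id)).measurable.comp hf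

theorem measurable_next {x w : Ω → Fin n → ℝ} {u : Ω → Fin m → ℝ} {d : Ω → ℝ} (hx : Measurable x)
    (hu : Measurable u) (hd : Measurable d) (hw : Measurable w) :
    Measurable fun ω => A *ᵥ x ω + B *ᵥ u ω + d ω • (C *ᵥ x ω + D *ᵥ u ω) + w ω :=
  (((measurable_mulVec A hx).add (measurable_mulVec B hu)).add
    (hd.smul ((measurable_mulVec C hx).add (measurable_mulVec D hu)))).add hw

variable {x0 : Ω → Fin n → ℝ} {d : ℕ → Ω → ℝ} {w : ℕ → Ω → Fin n → ℝ}

theorem measurable_history (hx : Measurable x0) (hd : ∀ k, Measurable (d k))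
    (hw : ∀ k, Measurable (w k)) (π : Policy n m) (k : ℕ) :
    Measurable fun ω => history A B C D π (x0 ω) (d · ω) (w · ω) k := by
  induction k with
  | zero => exact measurable_pi_iff.2 fun _ => hx
  | succ k ih =>
    refine measurable_pi_iff.2 fun i => ?_
    refine Fin.lastCases ?_ (fun i => ?_) i
    · simp only [history, Fin.snoc_last]
      exact measurable_next ((measurable_pi_apply _).comp ih) ((π.measurable_act k).comp ih)
        (hd k) (hw k)
    · simp only [history, Fin.snoc_castSucc]
      exact (measurable_pi_apply i).comp ih

theorem measurable_state (hx : Measurable x0) (hd : ∀ k, Measurable (d k))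
    (hw : ∀ k, Measurable (w k)) (π : Policy n m) (k : ℕ) :
    Measurable fun ω => state A B C D π (x0 ω) (d · ω) (w · ω) k :=
  (measurable_pi_apply (Fin.last k)).comp (measurable_history hx hd hw π k)

theorem measurable_input (hx : Measurable x0) (hd : ∀ k, Measurable (d k))
    (hw : ∀ k, Measurable (w k)) (π : Policy n m) (k : ℕ) :
    Measurable fun ω => input A B C D π (x0 ω) (d · ω) (w · ω) k :=
  (π.measurable_act k).comp (measurable_history hx hd hw π k)

end Dynamics

/-! ### Regrouping independence and integrating out independent noise -/

section Independence

variable {Ω : Type*} [MeasurableSpace Ω] {μ : Measure Ω}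

/-- The joint law is a triple product, which only has to be reassociated. It serves to group the
initial state with the past noise. -/
theorem indepFun_prodMk_left_of {α β δ : Type*} [MeasurableSpace α] [MeasurableSpace β]
    [MeasurableSpace δ] [IsProbabilityMeasure μ] {X : Ω → α} {Y : Ω → β} {Z : Ω → δ}
    (hX : Measurable X) (hY : Measurable Y) (hZ : Measurable Z)
    (hXYZ : IndepFun X (fun ω => (Y ω, Z ω)) μ) (hYZ : IndepFun Y Z μ) :
    IndepFun (fun ω => (X ω, Y ω)) Z μ := by
  have hXY : IndepFun X Y μ := hXYZ.comp measurable_id measurable_fst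
  have := Measure.isProbabilityMeasure_map (μ := μ) hX.aemeasurable
  have := Measure.isProbabilityMeasure_map (μ := μ) hY.aemeasurable
  have := Measure.isProbabilityMeasure_map (μ := μ) hZ.aemeasurable
  rw [indepFun_iff_map_prod_eq_prod_map_map (hX.prodMk hY).aemeasurable hZ.aemeasurable]
  rw [indepFun_iff_map_prod_eq_prod_map_map hX.aemeasurable hY.aemeasurable] at hXY
  rw [indepFun_iff_map_prod_eq_prod_map_map hY.aemeasurable hZ.aemeasurable] at hYZ
  rw [indepFun_iff_map_prod_eq_prod_map_map hX.aemeasurable (hY.prodMk hZ).aemeasurable, hYZ]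
    at hXYZ
  rw [hXY]
  have h := (measurePreserving_prodAssoc (μ.map X) (μ.map Y) (μ.map Z)).symm _
  rw [← h.map_eq, ← hXYZ, Measure.map_map MeasurableEquiv.prodAssoc.symm.measurable
    (hX.prodMk (hY.prodMk hZ))]
  rfl

/-- Tonelli on the product law. This replaces conditional expectation given the history and requires
no integrability. -/
theorem lintegral_indepFun {α β : Type*} [MeasurableSpace α] [MeasurableSpace β]
    [IsProbabilityMeasure μ] {X : Ω → α} {Y : Ω → β} (hX : Measurable X) (hY : Measurable Y)
    (hXY : IndepFun X Y μ) {F : α × β → ℝ≥0∞} (hF : Measurable F) :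
    ∫⁻ ω, F (X ω, Y ω) ∂μ = ∫⁻ ω, ∫⁻ ω', F (X ω, Y ω') ∂μ ∂μ := by
  have := Measure.isProbabilityMeasure_map (μ := μ) hY.aemeasurable
  have h := (indepFun_iff_map_prod_eq_prod_map_map hX.aemeasurable hY.aemeasurable).1 hXY
  rw [← lintegral_map hF (hX.prodMk hY), h, lintegral_prod _ hF.aemeasurable,
    lintegral_map hF.lintegral_prod_right' hX]
  refine lintegral_congr fun ω => ?_
  exact lintegral_map (hF.comp measurable_prodMk_left) hY

end Independence

/-! ### The one-step expectation, and existence of the noise -/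

section Noise

variable {n m : ℕ} {A : Matrix (Fin n) (Fin n) ℝ} {B : Matrix (Fin n) (Fin m) ℝ}
  {C : Matrix (Fin n) (Fin n) ℝ} {D : Matrix (Fin n) (Fin m) ℝ}
  {X0 W : Matrix (Fin n) (Fin n) ℝ}
  {Ω : Type*} [MeasurableSpace Ω] {μ : Measure Ω}
  {x0 : Ω → Fin n → ℝ} {d : ℕ → Ω → ℝ} {w : ℕ → Ω → Fin n → ℝ}

/-- The history up to `k` is a measurable function of `x0` and the noise at times `< k`, which are
jointly independent of the noise at time `k`. -/
theorem IsNoise.indepFun_history (h : IsNoise X0 W μ x0 d w) (π : Policy n m) (k : ℕ) :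
    IndepFun (fun ω => history A B C D π (x0 ω) (d · ω) (w · ω) k)
      (fun ω => (d k ω, w k ω)) μ := by
  have := h.isProbabilityMeasure
  let z : ℕ → Ω → ℝ × (Fin n → ℝ) := fun k ω => (d k ω, w k ω)
  have hz : ∀ k, Measurable (z k) := fun k => (h.measurable_mul k).prodMk (h.measurable_add k)
  let Z : Ω → Finset.range k → ℝ × (Fin n → ℝ) := fun ω j => z j ω
  have hZ : Measurable Z := measurable_pi_iff.2 fun j => hz j
  let last : ({k} : Finset ℕ) := ⟨k, Finset.mem_singleton_self k⟩
  have hZz : IndepFun Z (z k) μ :=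
    (h.indep_time.indepFun_finset (Finset.range k) {k} (by simp) hz).comp (φ := id)
      (ψ := fun f : ({k} : Finset ℕ) → ℝ × (Fin n → ℝ) => f last) measurable_id
      (measurable_pi_apply last)
  have hxZz : IndepFun x0 (fun ω => (Z ω, z k ω)) μ :=
    h.indep_init.comp (φ := id)
      (ψ := fun f : ℕ → ℝ × (Fin n → ℝ) => ((fun j : Finset.range k => f j), f k)) measurable_id
      ((measurable_pi_iff.2 fun j => measurable_pi_apply _).prodMk (measurable_pi_apply k))
  have hind := indepFun_prodMk_left_of h.measurable_init hZ (hz k) hxZz hZz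
  -- Padding with zeros from time `k` on is harmless: by `history_congr` those values do not enter
  -- the history.
  let ext : (Finset.range k → ℝ × (Fin n → ℝ)) → ℕ → ℝ × (Fin n → ℝ) :=
    fun f j => if hj : j ∈ Finset.range k then f ⟨j, hj⟩ else 0
  have hext : ∀ j, Measurable fun f => ext f j := by
    intro j
    by_cases hj : j ∈ Finset.range k
    · simpa only [ext, hj, dite_true] using measurable_pi_apply _
    · simpa only [ext, hj, dite_false] using measurable_const
  let f : (Fin n → ℝ) × (Finset.range k → ℝ × (Fin n → ℝ)) → Fin (k + 1) → Fin n → ℝ :=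
    fun p => history A B C D π p.1 (fun j => (ext p.2 j).1) (fun j => (ext p.2 j).2) k
  have hf : Measurable f := measurable_history (d := fun j p => (ext p.2 j).1)
    (w := fun j p => (ext p.2 j).2) measurable_fst
    (fun j => ((hext j).comp measurable_snd).fst) (fun j => ((hext j).comp measurable_snd).snd) π k
  have heq : (fun ω => history A B C D π (x0 ω) (d · ω) (w · ω) k) =
      f ∘ fun ω => (x0 ω, Z ω) := by
    funext ω
    refine history_congr π _ (fun j hj => ?_) fun j hj => ?_ <;>
      simp [ext, Z, z, hj]
  rw [heq]
  exact hind.comp hf measurable_id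

theorem IsNoise.lintegral_shift (h : IsNoise X0 W μ x0 d w) (hW : W.PosSemidef)
    {S : Matrix (Fin n) (Fin n) ℝ} (hS : S.PosSemidef) (a b : Fin n → ℝ) (k : ℕ) :
    ∫⁻ ω, ENNReal.ofReal ((a + d k ω • b + w k ω) ⬝ᵥ S *ᵥ (a + d k ω • b + w k ω)) ∂μ =
      ENNReal.ofReal (a ⬝ᵥ S *ᵥ a + b ⬝ᵥ S *ᵥ b) + ENNReal.ofReal (S * W).trace := by
  have := h.isProbabilityMeasure
  have hdm := (h.measurable_mul k).aemeasurable (μ := μ)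
  have hd : MemLp (d k) 2 μ := by
    have h1 : MemLp (id : ℝ → ℝ) 2 (gaussianReal 0 1) := IsGaussian.memLp_two_id
    rw [← h.law_mul k] at h1
    exact h1.comp_of_map hdm
  have hd1 : ∫ ω, d k ω ∂μ = 0 := by
    have h1 := integral_id_gaussianReal (μ := 0) (v := 1)
    rwa [← h.law_mul k, integral_map hdm (by fun_prop)] at h1
  have hd2 : ∫ ω, d k ω * d k ω ∂μ = 1 := by
    have h1 := variance_id_gaussianReal (μ := 0) (v := 1)
    rw [← h.law_mul k, variance_map (by fun_prop) hdm, Function.id_comp,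
      variance_of_integral_eq_zero hdm hd1] at h1
    simpa [sq] using h1
  have hw := memLp_of_law (h.measurable_add k) (h.law_add k)
  rw [lintegral_dotProduct_mulVec (y := fun ω => a + d k ω • b + w k ω)
    (M := Matrix.vecMulVec a a + Matrix.vecMulVec b b + W) ?_ ?_ hS]
  · rw [Matrix.mul_add, Matrix.mul_add, Matrix.trace_add, Matrix.trace_add, trace_mul_vecMulVec,
      trace_mul_vecMulVec]
    exact ENNReal.ofReal_add (add_nonneg ((posSemidef_iff_real.1 hS).2 a)
      ((posSemidef_iff_real.1 hS).2 b)) (trace_mul_nonneg hS hW)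
  · intro i
    exact ((memLp_const (a i)).add (hd.mul_const (b i))).add (hw i)
  · exact integral_noise_mul hd hd1 hd2 hw (integral_of_law (h.measurable_add k) (h.law_add k))
      (integral_mul_of_law (h.measurable_add k) hW (h.law_add k)) (h.indep_mul_add k) a b

/-- The conditional second moment formula, integrated: it holds in `[0, ∞]` for every policy. -/
theorem IsNoise.lintegral_state_succ (h : IsNoise X0 W μ x0 d w) (hW : W.PosSemidef)
    {S : Matrix (Fin n) (Fin n) ℝ} (hS : S.PosSemidef) (π : Policy n m) (k : ℕ) :
    ∫⁻ ω, ENNReal.ofReal (state A B C D π (x0 ω) (d · ω) (w · ω) (k + 1) ⬝ᵥ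
        S *ᵥ state A B C D π (x0 ω) (d · ω) (w · ω) (k + 1)) ∂μ =
      ∫⁻ ω, ENNReal.ofReal (nextForm A B C D S (state A B C D π (x0 ω) (d · ω) (w · ω) k)
        (input A B C D π (x0 ω) (d · ω) (w · ω) k)) ∂μ + ENNReal.ofReal (S * W).trace := by
  have := h.isProbabilityMeasure
  let next : (Fin (k + 1) → Fin n → ℝ) × (ℝ × (Fin n → ℝ)) → Fin n → ℝ := fun p =>
    A *ᵥ p.1 (Fin.last k) + B *ᵥ π.act k p.1
      + p.2.1 • (C *ᵥ p.1 (Fin.last k) + D *ᵥ π.act k p.1) + p.2.2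
  have hnext : Measurable next :=
    measurable_next ((measurable_pi_apply _).comp measurable_fst)
      ((π.measurable_act k).comp measurable_fst) measurable_snd.fst measurable_snd.snd
  have hF : Measurable fun p => ENNReal.ofReal (next p ⬝ᵥ S *ᵥ next p) :=
    (measurable_dotProduct_mulVec S hnext).ennreal_ofReal
  have key := lintegral_indepFun
    (measurable_history h.measurable_init h.measurable_mul h.measurable_add π k)
    ((h.measurable_mul k).prodMk (h.measurable_add k))
    (h.indepFun_history (A := A) (B := B) (C := C) (D := D) π k) hF
  simp only [state_succ]
  refine key.trans ?_
  calc _ = ∫⁻ ω, (ENNReal.ofReal (nextForm A B C D S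
          (state A B C D π (x0 ω) (d · ω) (w · ω) k)
          (input A B C D π (x0 ω) (d · ω) (w · ω) k)) + ENNReal.ofReal (S * W).trace) ∂μ :=
        lintegral_congr fun ω => h.lintegral_shift hW hS _ _ k
    _ = _ := by
      rw [lintegral_add_right _ measurable_const, lintegral_const, measure_univ, mul_one]

theorem IsNoise.lintegral_init (h : IsNoise X0 W μ x0 d w) (hX0 : X0.PosSemidef)
    {S : Matrix (Fin n) (Fin n) ℝ} (hS : S.PosSemidef) :
    ∫⁻ ω, ENNReal.ofReal (x0 ω ⬝ᵥ S *ᵥ x0 ω) ∂μ = ENNReal.ofReal (S * X0).trace :=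
  lintegral_dotProduct_mulVec (memLp_of_law h.measurable_init h.law_init)
    (integral_mul_of_law h.measurable_init hX0 h.law_init) hS

/-- Admissibility quantifies over realizations of the noise, so extracting moment convergence from
it requires one to exist; a product measure provides it. -/
theorem exists_isNoise (X0 W : Matrix (Fin n) (Fin n) ℝ) :
    ∃ (Ω : Type) (_ : MeasurableSpace Ω) (P : Measure Ω) (x0 : Ω → Fin n → ℝ) (d : ℕ → Ω → ℝ)
      (w : ℕ → Ω → Fin n → ℝ), IsNoise X0 W P x0 d w := by
  have hof : Measurable (WithLp.ofLp : EuclideanSpace ℝ (Fin n) → Fin n → ℝ) :=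
    WithLp.measurable_ofLp 2 _
  have hto : Measurable (WithLp.toLp 2 : (Fin n → ℝ) → EuclideanSpace ℝ (Fin n)) :=
    WithLp.measurable_toLp 2 _
  let ν : Matrix (Fin n) (Fin n) ℝ → Measure (Fin n → ℝ) := fun X =>
    (multivariateGaussian 0 X).map WithLp.ofLp
  have hν : ∀ X, IsProbabilityMeasure (ν X) := fun X =>
    Measure.isProbabilityMeasure_map hof.aemeasurable
  have hνto : ∀ X, (ν X).map (WithLp.toLp 2) = multivariateGaussian 0 X := by
    intro X
    rw [Measure.map_map hto hof]
    exact Measure.map_id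
  let ρ : Measure (ℝ × (Fin n → ℝ)) := (gaussianReal 0 1).prod (ν W)
  let κ : Measure (ℕ → ℝ × (Fin n → ℝ)) := Measure.infinitePi fun _ => ρ
  let P := (ν X0).prod κ
  have hfst : P.map Prod.fst = ν X0 := measurePreserving_fst.map_eq
  have hsnd : P.map Prod.snd = κ := measurePreserving_snd.map_eq
  have hev : ∀ k, P.map (fun ω => ω.2 k) = ρ := by
    intro k
    calc P.map (fun ω => ω.2 k) = (P.map Prod.snd).map (fun f => f k) :=
          (Measure.map_map (measurable_pi_apply k) measurable_snd).symm
      _ = ρ := by rw [hsnd, Measure.infinitePi_map_eval]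
  have hmeas : ∀ k, Measurable fun ω : (Fin n → ℝ) × (ℕ → ℝ × (Fin n → ℝ)) => ω.2 k := fun k =>
    (measurable_pi_apply k).comp measurable_snd
  have hd : ∀ k, P.map (fun ω => (ω.2 k).1) = gaussianReal 0 1 := by
    intro k
    calc P.map (fun ω => (ω.2 k).1) = (P.map (fun ω => ω.2 k)).map Prod.fst :=
          (Measure.map_map measurable_fst (hmeas k)).symm
      _ = gaussianReal 0 1 := by rw [hev]; exact measurePreserving_fst.map_eq
  have hw : ∀ k, P.map (fun ω => (ω.2 k).2) = ν W := by
    intro k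
    calc P.map (fun ω => (ω.2 k).2) = (P.map (fun ω => ω.2 k)).map Prod.snd :=
          (Measure.map_map measurable_snd (hmeas k)).symm
      _ = ν W := by rw [hev]; exact measurePreserving_snd.map_eq
  refine ⟨(Fin n → ℝ) × (ℕ → ℝ × (Fin n → ℝ)), inferInstance, P, Prod.fst,
    fun k ω => (ω.2 k).1, fun k ω => (ω.2 k).2, ?_⟩
  refine
    { isProbabilityMeasure := inferInstance
      measurable_init := measurable_fst
      measurable_mul := fun k => (hmeas k).fst
      measurable_add := fun k => (hmeas k).snd
      law_init := ?_
      law_mul := hd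
      law_add := fun k => ?_
      indep_mul_add := fun k => ?_
      indep_time := ?_
      indep_init := ?_ }
  · rw [← hνto, ← hfst, Measure.map_map hto measurable_fst]
    rfl
  · rw [← hνto, ← hw k, Measure.map_map hto (hmeas k).snd]
    rfl
  · rw [indepFun_iff_map_prod_eq_prod_map_map (hmeas k).fst.aemeasurable
      (hmeas k).snd.aemeasurable, hd, hw]
    exact hev k
  · rw [iIndepFun_iff_map_fun_eq_infinitePi_map hmeas]
    simp only [hev]
    exact hsnd
  · rw [indepFun_iff_map_prod_eq_prod_map_map measurable_fst.aemeasurable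
      measurable_snd.aemeasurable, hfst, hsnd]
    exact Measure.map_id

end Noise

/-! ### Time-varying feedbacks: admissibility as convergence of a matrix recursion -/

section TimeVarying

variable {n m : ℕ}

/-- The time varying linear policy `u_k = K k x_k`. -/
def Policy.timeLinear (K : ℕ → Matrix (Fin m) (Fin n) ℝ) : Policy n m where
  act k h := K k *ᵥ h (Fin.last k)
  measurable_act k := (Policy.linear (K k)).measurable_act k

theorem Policy.linear_eq_timeLinear (L : Matrix (Fin m) (Fin n) ℝ) :
    Policy.linear L = Policy.timeLinear fun _ => L := rfl

variable (A : Matrix (Fin n) (Fin n) ℝ) (B : Matrix (Fin n) (Fin m) ℝ)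
  (C : Matrix (Fin n) (Fin n) ℝ) (D : Matrix (Fin n) (Fin m) ℝ)
  (W : Matrix (Fin n) (Fin n) ℝ)

/-- The second moments of the state under the policy `u_k = K k x_k`. -/
def momentSeq (K : ℕ → Matrix (Fin m) (Fin n) ℝ) (X0 : Matrix (Fin n) (Fin n) ℝ) :
    ℕ → Matrix (Fin n) (Fin n) ℝ
  | 0 => X0
  | k + 1 => momentStep A B C D W (K k) (momentSeq K X0 k)

variable {A B C D W}

theorem momentSeq_posSemidef (hW : W.PosSemidef) (K : ℕ → Matrix (Fin m) (Fin n) ℝ)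
    {X0 : Matrix (Fin n) (Fin n) ℝ} (hX0 : X0.PosSemidef) (k : ℕ) :
    (momentSeq A B C D W K X0 k).PosSemidef := by
  induction k with
  | zero => exact hX0
  | succ k ih => exact momentStep_posSemidef hW _ ih

theorem momentSeq_add {K : ℕ → Matrix (Fin m) (Fin n) ℝ} {L : Matrix (Fin m) (Fin n) ℝ} {N : ℕ}
    (hK : ∀ k, N ≤ k → K k = L) (X0 : Matrix (Fin n) (Fin n) ℝ) (k : ℕ) :
    momentSeq A B C D W K X0 (k + N) =
      (momentStep A B C D W L)^[k] (momentSeq A B C D W K X0 N) := by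
  induction k with
  | zero => rw [zero_add]; rfl
  | succ k ih =>
    rw [Function.iterate_succ_apply', ← ih, Nat.succ_add, momentSeq, hK _ (Nat.le_add_left N k)]

theorem history_congr_policy {π π' : Policy n m} {k : ℕ} (hπ : ∀ j < k, π.act j = π'.act j)
    (ξ : Fin n → ℝ) (d : ℕ → ℝ) (w : ℕ → Fin n → ℝ) :
    history A B C D π ξ d w k = history A B C D π' ξ d w k := by
  induction k with
  | zero => rfl
  | succ k ih =>
    have := ih fun j hj => hπ j (hj.trans k.lt_succ_self)
    simp only [history, this, hπ k k.lt_succ_self]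

variable {X0 : Matrix (Fin n) (Fin n) ℝ} {Ω : Type*} [MeasurableSpace Ω] {μ : Measure Ω}
  {x0 : Ω → Fin n → ℝ} {d : ℕ → Ω → ℝ} {w : ℕ → Ω → Fin n → ℝ}

/-- Induction with `S` generalized, pulling it back through `adjointStep`. Working in `[0, ∞]` makes
finiteness of the moments a conclusion. -/
theorem IsNoise.lintegral_timeLinear (h : IsNoise X0 W μ x0 d w) (hX0 : X0.PosSemidef)
    (hW : W.PosSemidef) (K : ℕ → Matrix (Fin m) (Fin n) ℝ) (k : ℕ)
    {S : Matrix (Fin n) (Fin n) ℝ} (hS : S.PosSemidef) :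
    ∫⁻ ω, ENNReal.ofReal (state A B C D (Policy.timeLinear K) (x0 ω) (d · ω) (w · ω) k ⬝ᵥ
        S *ᵥ state A B C D (Policy.timeLinear K) (x0 ω) (d · ω) (w · ω) k) ∂μ =
      ENNReal.ofReal (S * momentSeq A B C D W K X0 k).trace := by
  induction k generalizing S with
  | zero => exact h.lintegral_init hX0 hS
  | succ k ih =>
    have hadj := adjointStep_posSemidef (A := A) (B := B) (C := C) (D := D) (K k) hS
    rw [h.lintegral_state_succ hW hS, momentSeq, trace_mul_momentStep, ENNReal.ofReal_add
      (trace_mul_nonneg hadj (momentSeq_posSemidef hW K hX0 k)) (trace_mul_nonneg hS hW), ← ih hadj]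
    congr 1
    refine lintegral_congr fun ω => ?_
    rw [dotProduct_adjointStep]
    rfl

theorem IsNoise.secondMoment_timeLinear (h : IsNoise X0 W μ x0 d w) (hX0 : X0.PosSemidef)
    (hW : W.PosSemidef) (K : ℕ → Matrix (Fin m) (Fin n) ℝ) (k : ℕ) :
    (∀ i, MemLp (fun ω => state A B C D (Policy.timeLinear K) (x0 ω) (d · ω) (w · ω) k i) 2 μ) ∧
    ∀ i j, ∫ ω, state A B C D (Policy.timeLinear K) (x0 ω) (d · ω) (w · ω) k i *
      state A B C D (Policy.timeLinear K) (x0 ω) (d · ω) (w · ω) k j ∂μ =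
        momentSeq A B C D W K X0 k i j :=
  memLp_and_integral_of_lintegral
    (measurable_state h.measurable_init h.measurable_mul h.measurable_add _ k)
    (momentSeq_posSemidef hW K hX0 k) fun _ hS => h.lintegral_timeLinear hX0 hW K k hS

theorem isAdmissible_timeLinear_iff (hW : W.PosSemidef) (K : ℕ → Matrix (Fin m) (Fin n) ℝ) :
    IsAdmissible A B C D W (Policy.timeLinear K) ↔
      ∃ X : Matrix (Fin n) (Fin n) ℝ, X.PosSemidef ∧
        ∀ X0 : Matrix (Fin n) (Fin n) ℝ, X0.PosSemidef →
          Tendsto (momentSeq A B C D W K X0) atTop (𝓝 X) := by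
  constructor
  · rintro ⟨X, hX, h⟩
    refine ⟨X, hX, fun X0 hX0 => ?_⟩
    obtain ⟨Ω, _, P, x0, d, w, hn⟩ := exists_isNoise X0 W
    refine (h X0 hX0 Ω P x0 d w hn).2.congr fun k => ?_
    ext i j
    exact (hn.secondMoment_timeLinear hX0 hW K k).2 i j
  · rintro ⟨X, hX, h⟩
    refine ⟨X, hX, fun X0 hX0 Ω _ P x0 d w hn => ⟨fun k =>
      (hn.secondMoment_timeLinear hX0 hW K k).1, (h X0 hX0).congr fun k => ?_⟩⟩
    ext i j
    exact ((hn.secondMoment_timeLinear hX0 hW K k).2 i j).symm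

theorem isAdmissible_linear_iff (hW : W.PosSemidef) (L : Matrix (Fin m) (Fin n) ℝ) :
    IsAdmissible A B C D W (Policy.linear L) ↔
      ∃ X : Matrix (Fin n) (Fin n) ℝ, X.PosSemidef ∧
        ∀ X0 : Matrix (Fin n) (Fin n) ℝ, X0.PosSemidef →
          Tendsto (fun k => (momentStep A B C D W L)^[k] X0) atTop (𝓝 X) := by
  rw [Policy.linear_eq_timeLinear, isAdmissible_timeLinear_iff hW]
  have h : ∀ X0, momentSeq A B C D W (fun _ => L) X0 =
      fun k => (momentStep A B C D W L)^[k] X0 := fun X0 =>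
    funext fun k => momentSeq_add (N := 0) (fun _ _ => rfl) X0 k
  simp only [h]

/-- Switching to an admissible feedback after finitely many steps is admissible. -/
theorem isAdmissible_switch (hW : W.PosSemidef) {L : Matrix (Fin m) (Fin n) ℝ}
    (hL : IsAdmissible A B C D W (Policy.linear L)) {K : ℕ → Matrix (Fin m) (Fin n) ℝ} {N : ℕ}
    (hK : ∀ k, N ≤ k → K k = L) : IsAdmissible A B C D W (Policy.timeLinear K) := by
  obtain ⟨X, hX, h⟩ := (isAdmissible_linear_iff hW L).1 hL
  refine (isAdmissible_timeLinear_iff hW K).2 ⟨X, hX, fun X0 hX0 => ?_⟩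
  -- The limit `X` does not depend on the initial covariance, so the moment at the switching time is
  -- just another starting point.
  rw [← tendsto_add_atTop_iff_nat N]
  simp only [momentSeq_add hK]
  exact h _ (momentSeq_posSemidef hW K hX0 N)

end TimeVarying

/-! ### Discounted telescoping in `[0, ∞]` -/

section Telescoping

variable {c J g : ℕ → ℝ≥0∞} {r t : ℝ≥0∞}

/-- Intended reading: `c` stage cost, `J` value, `g` gap, `t` noise contribution, `r` discount. The
additive form avoids truncated subtraction. -/
theorem sum_add_eq_of_step (h : ∀ k, c k + r * J (k + 1) = J k + g k + r * t) (N : ℕ) :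
    ∑ k ∈ Finset.range N, r ^ k * c k + r ^ N * J N =
      J 0 + ∑ k ∈ Finset.range N, r ^ k * (g k + r * t) := by
  induction N with
  | zero => simp
  | succ N ih =>
    rw [Finset.sum_range_succ, Finset.sum_range_succ, ← add_assoc, ← ih]
    calc _ = ∑ k ∈ Finset.range N, r ^ k * c k + r ^ N * (c N + r * J (N + 1)) := by ring
      _ = _ := by rw [h]; ring

/-- Discarding the remainder `r ^ N * J N` gives a bound without any finiteness assumption, so it
can be used to prove finiteness. -/
theorem tsum_le_of_step (h : ∀ k, c k + r * J (k + 1) = J k + g k + r * t) :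
    ∑' k, r ^ k * c k ≤ J 0 + ∑' k, r ^ k * (g k + r * t) := by
  refine ENNReal.tsum_le_of_sum_range_le fun N => ?_
  calc _ ≤ ∑ k ∈ Finset.range N, r ^ k * c k + r ^ N * J N := le_self_add
    _ = _ := sum_add_eq_of_step h N
    _ ≤ _ := by gcongr; exact ENNReal.sum_le_tsum _

/-- Terms of a finite sum tend to `0`, and `J ≤ b * c` passes this on to the remainder. -/
theorem tsum_eq_of_step (h : ∀ k, c k + r * J (k + 1) = J k + g k + r * t)
    (hc : ∑' k, r ^ k * c k ≠ ⊤) {b : ℝ≥0∞} (hb : b ≠ ⊤) (hJ : ∀ k, J k ≤ b * c k) :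
    ∑' k, r ^ k * c k = J 0 + ∑' k, r ^ k * (g k + r * t) := by
  have h0 : Tendsto (fun k => r ^ k * J k) atTop (𝓝 0) := by
    have h1 := ENNReal.Tendsto.const_mul (a := b)
      (ENNReal.tendsto_atTop_zero_of_tsum_ne_top hc) (Or.inr hb)
    rw [mul_zero] at h1
    refine tendsto_of_tendsto_of_tendsto_of_le_of_le tendsto_const_nhds h1
      (fun _ => zero_le) fun k => ?_
    calc r ^ k * J k ≤ r ^ k * (b * c k) := by gcongr; exact hJ k
      _ = b * (r ^ k * c k) := by ring
  have h2 := (ENNReal.tendsto_nat_tsum fun k => r ^ k * c k).add h0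
  have h3 := (ENNReal.tendsto_nat_tsum fun k => r ^ k * (g k + r * t)).const_add (J 0)
  simp only [sum_add_eq_of_step h, add_zero] at h2
  exact tendsto_nhds_unique h2 h3

theorem tsum_pow_mul_ne_top {r t : ℝ≥0∞} (hr : r < 1) (ht : t ≠ ⊤) : ∑' k : ℕ, r ^ k * t ≠ ⊤ := by
  rw [ENNReal.tsum_mul_right, ENNReal.tsum_geometric]
  exact ENNReal.mul_ne_top (ENNReal.inv_ne_top.2 (tsub_pos_of_lt hr).ne') ht

end Telescoping

/-! ### Bellman identity and comparison of costs -/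

section Cost

variable {n m : ℕ} {A : Matrix (Fin n) (Fin n) ℝ} {B : Matrix (Fin n) (Fin m) ℝ}
  {C : Matrix (Fin n) (Fin n) ℝ} {D : Matrix (Fin n) (Fin m) ℝ}
  {X0 W Q : Matrix (Fin n) (Fin n) ℝ} {R : Matrix (Fin m) (Fin m) ℝ} {γ : ℝ}
  {Ω : Type*} [MeasurableSpace Ω] {μ : Measure Ω}
  {x0 : Ω → Fin n → ℝ} {d : ℕ → Ω → ℝ} {w : ℕ → Ω → Fin n → ℝ}

variable (A B C D Q R μ x0 d w) in
/-- The expected one step cost at time `k`. -/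
noncomputable def expStageCost (π : Policy n m) (k : ℕ) : ℝ≥0∞ :=
  ∫⁻ ω, ENNReal.ofReal (stageCost Q R (state A B C D π (x0 ω) (d · ω) (w · ω) k)
    (input A B C D π (x0 ω) (d · ω) (w · ω) k)) ∂μ

variable (A B C D μ x0 d w) in
/-- The expectation of `x_kᵀ S x_k`. -/
noncomputable def expForm (S : Matrix (Fin n) (Fin n) ℝ) (π : Policy n m) (k : ℕ) : ℝ≥0∞ :=
  ∫⁻ ω, ENNReal.ofReal (state A B C D π (x0 ω) (d · ω) (w · ω) k ⬝ᵥ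
    S *ᵥ state A B C D π (x0 ω) (d · ω) (w · ω) k) ∂μ

variable (A B C D μ x0 d w) in
/-- The expectation of `(u_k - L x_k)ᵀ H (u_k - L x_k)`. -/
noncomputable def expGap (H : Matrix (Fin m) (Fin m) ℝ) (L : Matrix (Fin m) (Fin n) ℝ)
    (π : Policy n m) (k : ℕ) : ℝ≥0∞ :=
  ∫⁻ ω, ENNReal.ofReal
    ((input A B C D π (x0 ω) (d · ω) (w · ω) k -
        L *ᵥ state A B C D π (x0 ω) (d · ω) (w · ω) k) ⬝ᵥ
      H *ᵥ (input A B C D π (x0 ω) (d · ω) (w · ω) k -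
        L *ᵥ state A B C D π (x0 ω) (d · ω) (w · ω) k)) ∂μ

theorem IsNoise.measurable_gap (h : IsNoise X0 W μ x0 d w) (L : Matrix (Fin m) (Fin n) ℝ)
    (π : Policy n m) (k : ℕ) :
    Measurable fun ω => input A B C D π (x0 ω) (d · ω) (w · ω) k -
      L *ᵥ state A B C D π (x0 ω) (d · ω) (w · ω) k :=
  (measurable_input h.measurable_init h.measurable_mul h.measurable_add π k).sub
    (measurable_mulVec L (measurable_state h.measurable_init h.measurable_mul h.measurable_add π k))

theorem IsNoise.measurable_stageCost (h : IsNoise X0 W μ x0 d w) (π : Policy n m) (k : ℕ) :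
    Measurable fun ω => stageCost Q R (state A B C D π (x0 ω) (d · ω) (w · ω) k)
      (input A B C D π (x0 ω) (d · ω) (w · ω) k) :=
  (measurable_dotProduct_mulVec Q
    (measurable_state h.measurable_init h.measurable_mul h.measurable_add π k)).add
  (measurable_dotProduct_mulVec R
    (measurable_input h.measurable_init h.measurable_mul h.measurable_add π k))

theorem IsNoise.measurable_nextForm (h : IsNoise X0 W μ x0 d w) (S : Matrix (Fin n) (Fin n) ℝ)
    (π : Policy n m) (k : ℕ) :
    Measurable fun ω => nextForm A B C D S (state A B C D π (x0 ω) (d · ω) (w · ω) k)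
      (input A B C D π (x0 ω) (d · ω) (w · ω) k) := by
  have hx := measurable_state (A := A) (B := B) (C := C) (D := D)
    h.measurable_init h.measurable_mul h.measurable_add π k
  have hu := measurable_input (A := A) (B := B) (C := C) (D := D)
    h.measurable_init h.measurable_mul h.measurable_add π k
  exact (measurable_dotProduct_mulVec S ((measurable_mulVec A hx).add (measurable_mulVec B hu))).add
    (measurable_dotProduct_mulVec S ((measurable_mulVec C hx).add (measurable_mulVec D hu)))

theorem IsNoise.cost_eq_tsum (h : IsNoise X0 W μ x0 d w) (hγ : 0 ≤ γ) (π : Policy n m) :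
    cost A B C D Q R γ μ x0 d w π =
      ∑' k, ENNReal.ofReal γ ^ k * expStageCost A B C D Q R μ x0 d w π k := by
  have hm := fun k => (h.measurable_stageCost (A := A) (B := B) (C := C) (D := D)
    (Q := Q) (R := R) π k)
  refine (lintegral_tsum fun k =>
    ((hm k).const_mul (γ ^ k)).ennreal_ofReal.aemeasurable).trans (tsum_congr fun k => ?_)
  rw [expStageCost, ← ENNReal.ofReal_pow hγ, ← lintegral_const_mul _ (hm k).ennreal_ofReal]
  exact lintegral_congr fun ω => ENNReal.ofReal_mul (pow_nonneg hγ k)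

/-- The expected one step cost plus the discounted next value of `S`. -/
theorem IsNoise.expStageCost_add (h : IsNoise X0 W μ x0 d w) (hW : W.PosSemidef) (hQ : Q.PosDef)
    (hR : R.PosDef) (hγ : 0 ≤ γ) {S : Matrix (Fin n) (Fin n) ℝ} (hS : S.PosSemidef)
    (π : Policy n m) (k : ℕ) :
    expStageCost A B C D Q R μ x0 d w π k
        + ENNReal.ofReal γ * expForm A B C D μ x0 d w S π (k + 1) =
      ∫⁻ ω, ENNReal.ofReal (stageCost Q R (state A B C D π (x0 ω) (d · ω) (w · ω) k)
          (input A B C D π (x0 ω) (d · ω) (w · ω) k)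
        + γ * nextForm A B C D S (state A B C D π (x0 ω) (d · ω) (w · ω) k)
          (input A B C D π (x0 ω) (d · ω) (w · ω) k)) ∂μ
        + ENNReal.ofReal γ * ENNReal.ofReal (S * W).trace := by
  rw [expForm, h.lintegral_state_succ hW hS, mul_add, ← add_assoc, expStageCost,
    ← lintegral_const_mul _ (h.measurable_nextForm S π k).ennreal_ofReal,
    ← lintegral_add_left (h.measurable_stageCost π k).ennreal_ofReal]
  congr 1
  refine lintegral_congr fun ω => ?_
  rw [← ENNReal.ofReal_mul hγ, ENNReal.ofReal_add (stageCost_nonneg hQ hR _ _)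
    (mul_nonneg hγ (nextForm_nonneg hS _ _))]

theorem IsNoise.expStageCost_step (h : IsNoise X0 W μ x0 d w) (hW : W.PosSemidef) (hQ : Q.PosDef)
    (hR : R.PosDef) (hγ : 0 ≤ γ) {P : Matrix (Fin n) (Fin n) ℝ} (hP : P.PosSemidef)
    (hPF : riccatiMap A B C D Q R γ P = P) (π : Policy n m) (k : ℕ) :
    expStageCost A B C D Q R μ x0 d w π k
        + ENNReal.ofReal γ * expForm A B C D μ x0 d w P π (k + 1) =
      expForm A B C D μ x0 d w P π k
        + expGap A B C D μ x0 d w (weight B D R γ P) (gain A B C D R γ P) π k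
        + ENNReal.ofReal γ * ENNReal.ofReal (P * W).trace := by
  rw [h.expStageCost_add hW hQ hR hγ hP, expForm, expGap, ← lintegral_add_left
    (measurable_dotProduct_mulVec P (measurable_state h.measurable_init h.measurable_mul
      h.measurable_add π k)).ennreal_ofReal]
  congr 1
  refine lintegral_congr fun ω => ?_
  rw [stageCost_add_nextForm hR hγ hP, hPF, ENNReal.ofReal_add
    ((posSemidef_iff_real.1 hP).2 _)
    ((posSemidef_iff_real.1 (weight_posDef hR hγ hP).posSemidef).2 _)]

theorem exists_expForm_le (hQ : Q.PosDef) (hR : R.PosDef) (S : Matrix (Fin n) (Fin n) ℝ) :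
    ∃ b : ℝ≥0∞, b ≠ ⊤ ∧ ∀ (π : Policy n m) (k : ℕ), expForm A B C D μ x0 d w S π k ≤
      b * expStageCost A B C D Q R μ x0 d w π k := by
  obtain ⟨c, hc, hSQ⟩ := exists_dotProduct_mulVec_le (S := S) hQ
  refine ⟨ENNReal.ofReal c, ENNReal.ofReal_ne_top, fun π k => ?_⟩
  rw [expForm, expStageCost, ← lintegral_const_mul' _ _ ENNReal.ofReal_ne_top]
  refine lintegral_mono fun ω => ?_
  rw [← ENNReal.ofReal_mul hc.le]
  exact ENNReal.ofReal_le_ofReal ((hSQ _).trans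
    (mul_le_mul_of_nonneg_left (dotProduct_mulVec_le_stageCost hR _ _) hc.le))

/-- Among the three terms only the gaps depend on the policy. Finite cost is what makes the
telescoping remainder vanish. -/
theorem IsNoise.cost_eq_add_gap (h : IsNoise X0 W μ x0 d w) (hW : W.PosSemidef)
    (hQ : Q.PosDef) (hR : R.PosDef) (hγ : 0 ≤ γ) {P : Matrix (Fin n) (Fin n) ℝ}
    (hP : P.PosSemidef) (hPF : riccatiMap A B C D Q R γ P = P) (π : Policy n m)
    (hπ : cost A B C D Q R γ μ x0 d w π ≠ ⊤) :
    cost A B C D Q R γ μ x0 d w π =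
      expForm A B C D μ x0 d w P π 0
        + ∑' k : ℕ, ENNReal.ofReal γ ^ k * (ENNReal.ofReal γ * ENNReal.ofReal (P * W).trace)
        + ∑' k, ENNReal.ofReal γ ^ k *
          expGap A B C D μ x0 d w (weight B D R γ P) (gain A B C D R γ P) π k := by
  obtain ⟨b, hb, hle⟩ := exists_expForm_le (A := A) (B := B) (C := C) (D := D) (μ := μ)
    (x0 := x0) (d := d) (w := w) hQ hR P
  rw [h.cost_eq_tsum hγ] at hπ ⊢
  rw [tsum_eq_of_step (h.expStageCost_step hW hQ hR hγ hP hPF π) hπ hb (hle π)]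
  simp only [mul_add]
  rw [ENNReal.tsum_add, add_assoc, add_comm (∑' _, _)]

theorem expGap_linear (H : Matrix (Fin m) (Fin m) ℝ) (L : Matrix (Fin m) (Fin n) ℝ) (k : ℕ) :
    expGap A B C D μ x0 d w H L (Policy.linear L) k = 0 := by
  simp [expGap, input_linear]

/-- With zero gaps the telescoping inequality bounds the cost by the initial value plus a geometric
series; the exact identity would presuppose finiteness. -/
theorem IsNoise.cost_linear_ne_top (h : IsNoise X0 W μ x0 d w) (hX0 : X0.PosSemidef)
    (hW : W.PosSemidef) (hQ : Q.PosDef) (hR : R.PosDef) (hγ : 0 ≤ γ) (hγ1 : γ < 1)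
    {P : Matrix (Fin n) (Fin n) ℝ} (hP : P.PosSemidef)
    (hPF : riccatiMap A B C D Q R γ P = P) :
    cost A B C D Q R γ μ x0 d w (Policy.linear (gain A B C D R γ P)) ≠ ⊤ := by
  rw [h.cost_eq_tsum hγ]
  refine ne_top_of_le_ne_top ?_ (tsum_le_of_step (h.expStageCost_step hW hQ hR hγ hP hPF _))
  simp only [expGap_linear, zero_add]
  refine ENNReal.add_ne_top.2 ⟨?_, tsum_pow_mul_ne_top (by simpa using hγ1)
    (ENNReal.mul_ne_top ENNReal.ofReal_ne_top ENNReal.ofReal_ne_top)⟩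
  simp only [expForm, state_zero]
  rw [h.lintegral_init hX0 hP]
  exact ENNReal.ofReal_ne_top

theorem expForm_zero (S : Matrix (Fin n) (Fin n) ℝ) (π π' : Policy n m) :
    expForm A B C D μ x0 d w S π 0 = expForm A B C D μ x0 d w S π' 0 := by
  simp only [expForm, state_zero]

/-- The excess cost of a policy over the optimal feedback. -/
theorem IsNoise.cost_eq_cost_linear_add (h : IsNoise X0 W μ x0 d w) (hX0 : X0.PosSemidef)
    (hW : W.PosSemidef) (hQ : Q.PosDef) (hR : R.PosDef) (hγ : 0 ≤ γ) (hγ1 : γ < 1)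
    {P : Matrix (Fin n) (Fin n) ℝ} (hP : P.PosSemidef)
    (hPF : riccatiMap A B C D Q R γ P = P) (π : Policy n m)
    (hπ : cost A B C D Q R γ μ x0 d w π ≠ ⊤) :
    cost A B C D Q R γ μ x0 d w π =
      cost A B C D Q R γ μ x0 d w (Policy.linear (gain A B C D R γ P))
        + ∑' k, ENNReal.ofReal γ ^ k *
          expGap A B C D μ x0 d w (weight B D R γ P) (gain A B C D R γ P) π k := by
  rw [h.cost_eq_add_gap hW hQ hR hγ hP hPF π hπ, h.cost_eq_add_gap hW hQ hR hγ hP hPF _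
    (h.cost_linear_ne_top hX0 hW hQ hR hγ hγ1 hP hPF), expForm_zero P π (Policy.linear (gain A B C D R γ P))]
  simp [expGap_linear]

theorem IsNoise.ae_eq_of_expGap_eq_zero (h : IsNoise X0 W μ x0 d w)
    {H : Matrix (Fin m) (Fin m) ℝ} (hH : H.PosDef) {L : Matrix (Fin m) (Fin n) ℝ}
    {π : Policy n m} {k : ℕ} (hg : expGap A B C D μ x0 d w H L π k = 0) :
    ∀ᵐ ω ∂μ, input A B C D π (x0 ω) (d · ω) (w · ω) k =
      L *ᵥ state A B C D π (x0 ω) (d · ω) (w · ω) k := by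
  rw [expGap, lintegral_eq_zero_iff
    (measurable_dotProduct_mulVec H (h.measurable_gap L π k)).ennreal_ofReal] at hg
  filter_upwards [hg] with ω hω
  by_contra hne
  have := (posDef_iff_real.1 hH).2 _ (sub_ne_zero.2 hne)
  simp only [Pi.zero_apply, ENNReal.ofReal_eq_zero] at hω
  linarith

theorem expStageCost_congr {π π' : Policy n m} {k : ℕ} (hπ : ∀ j ≤ k, π.act j = π'.act j) :
    expStageCost A B C D Q R μ x0 d w π k = expStageCost A B C D Q R μ x0 d w π' k := by
  simp only [expStageCost, state, input, hπ k le_rfl,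
    history_congr_policy (fun j hj => hπ j hj.le) (A := A) (B := B) (C := C) (D := D)]

theorem expForm_congr {π π' : Policy n m} {k : ℕ} (hπ : ∀ j < k, π.act j = π'.act j)
    (S : Matrix (Fin n) (Fin n) ℝ) :
    expForm A B C D μ x0 d w S π k = expForm A B C D μ x0 d w S π' k := by
  simp only [expForm, state, history_congr_policy hπ (A := A) (B := B) (C := C) (D := D)]

/-- The cost of a policy which agrees with `π` up to time `N` and then applies the feedback `L`
with discounted cost matrix `S`. -/
theorem IsNoise.cost_switch_le (h : IsNoise X0 W μ x0 d w) (hW : W.PosSemidef)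
    (hQ : Q.PosDef) (hR : R.PosDef) (hγ : 0 ≤ γ) {S : Matrix (Fin n) (Fin n) ℝ}
    (hS : S.PosSemidef) {L : Matrix (Fin m) (Fin n) ℝ}
    (hL : ∀ x, stageCost Q R x (L *ᵥ x) + γ * nextForm A B C D S x (L *ᵥ x) = x ⬝ᵥ S *ᵥ x)
    {π π' : Policy n m} {N : ℕ} (hlt : ∀ j < N, π'.act j = π.act j)
    (hge : ∀ j, N ≤ j → π'.act j = (Policy.linear L).act j) :
    cost A B C D Q R γ μ x0 d w π' ≤ cost A B C D Q R γ μ x0 d w π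
      + ENNReal.ofReal γ ^ N * (expForm A B C D μ x0 d w S π N
        + ∑' k : ℕ, ENNReal.ofReal γ ^ k * (ENNReal.ofReal γ * ENNReal.ofReal (S * W).trace)) := by
  set r := ENNReal.ofReal γ
  rw [h.cost_eq_tsum hγ, h.cost_eq_tsum hγ, ← Summable.sum_add_tsum_nat_add' (k := N)
    (f := fun k => r ^ k * expStageCost A B C D Q R μ x0 d w π' k) ENNReal.summable]
  refine add_le_add ?_ ?_
  · refine le_trans (Finset.sum_le_sum fun k hk => ?_) (ENNReal.sum_le_tsum (Finset.range N))
    rw [expStageCost_congr fun j hj => hlt j (hj.trans_lt (Finset.mem_range.1 hk))]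
  -- From time `N` on the Lyapunov equation for `L` holds exactly, so the gap is `0`.
  · have hstep : ∀ k, expStageCost A B C D Q R μ x0 d w π' (k + N)
        + r * expForm A B C D μ x0 d w S π' (k + 1 + N) =
        expForm A B C D μ x0 d w S π' (k + N) + 0 + r * ENNReal.ofReal (S * W).trace := by
      intro k
      rw [Nat.add_right_comm, add_zero]
      refine (h.expStageCost_add hW hQ hR hγ hS π' (k + N)).trans ?_
      congr 1
      refine lintegral_congr fun ω => ?_
      have hu : input A B C D π' (x0 ω) (d · ω) (w · ω) (k + N) =
          L *ᵥ state A B C D π' (x0 ω) (d · ω) (w · ω) (k + N) := by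
        rw [input, hge (k + N) (Nat.le_add_left N k)]
        rfl
      rw [hu, hL]
    have hle := tsum_le_of_step (c := fun k => expStageCost A B C D Q R μ x0 d w π' (k + N))
      (J := fun k => expForm A B C D μ x0 d w S π' (k + N)) (g := fun _ => 0) hstep
    simp only [zero_add] at hle
    rw [expForm_congr hlt] at hle
    calc _ = r ^ N * ∑' k, r ^ k * expStageCost A B C D Q R μ x0 d w π' (k + N) := by
          rw [← ENNReal.tsum_mul_left]
          exact tsum_congr fun k => by ring
      _ ≤ _ := by gcongr

end Cost

end StochLQR

/-! ### Assembly of the theorem -/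

theorem lemma5 {n m : ℕ}
    (A : Matrix (Fin n) (Fin n) ℝ) (B : Matrix (Fin n) (Fin m) ℝ)
    (C : Matrix (Fin n) (Fin n) ℝ) (D : Matrix (Fin n) (Fin m) ℝ)
    (X0 W Q : Matrix (Fin n) (Fin n) ℝ) (R : Matrix (Fin m) (Fin m) ℝ) (γ : ℝ)
    (hX0 : X0.PosSemidef) (hW : W.PosSemidef) (hQ : Q.PosDef) (hR : R.PosDef)
    (hγ0 : 0 ≤ γ) (hγ1 : γ < 1)
    {Ω : Type*} [MeasurableSpace Ω] (μ : Measure Ω)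
    (x0 : Ω → Fin n → ℝ) (d : ℕ → Ω → ℝ) (w : ℕ → Ω → Fin n → ℝ)
    (hnoise : StochLQR.IsNoise X0 W μ x0 d w)
    (hadm : ∃ L : Matrix (Fin m) (Fin n) ℝ,
      StochLQR.IsAdmissible A B C D W (StochLQR.Policy.linear L)) :
    ∃ (P : Matrix (Fin n) (Fin n) ℝ) (L : Matrix (Fin m) (Fin n) ℝ),
      -- `P` is positive definite and is the unique solution of the Riccati equation
      P.PosDef ∧ StochLQR.SARE A B C D Q R γ P ∧
      (∀ P' : Matrix (Fin n) (Fin n) ℝ, P'.PosSemidef →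
        StochLQR.SARE A B C D Q R γ P' → P' = P) ∧
      -- the inverse in the Riccati equation and in the gain is a genuine inverse
      (StochLQR.weight B D R γ P).PosDef ∧
      L = StochLQR.gain A B C D R γ P ∧
      -- the policy `u = L x` has finite cost, and no policy has a smaller cost
      StochLQR.cost A B C D Q R γ μ x0 d w (StochLQR.Policy.linear L) ≠ ⊤ ∧
      (∀ π : StochLQR.Policy n m,
        StochLQR.cost A B C D Q R γ μ x0 d w (StochLQR.Policy.linear L) ≤
          StochLQR.cost A B C D Q R γ μ x0 d w π) ∧
      -- its cost is the optimal cost over the admissible policies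
      IsGLB (StochLQR.cost A B C D Q R γ μ x0 d w '' {π | StochLQR.IsAdmissible A B C D W π})
        (StochLQR.cost A B C D Q R γ μ x0 d w (StochLQR.Policy.linear L)) ∧
      -- if `u = L x` is itself admissible, it attains the minimum over the admissible policies
      (StochLQR.IsAdmissible A B C D W (StochLQR.Policy.linear L) →
        IsLeast (StochLQR.cost A B C D Q R γ μ x0 d w '' {π | StochLQR.IsAdmissible A B C D W π})
          (StochLQR.cost A B C D Q R γ μ x0 d w (StochLQR.Policy.linear L))) ∧
      -- every optimal policy applies the control `u_k = L x_k` almost surely, at every time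
      -- (only at time `0` when `γ = 0`, where later controls do not enter the cost)
      (∀ π : StochLQR.Policy n m,
        StochLQR.cost A B C D Q R γ μ x0 d w π =
          StochLQR.cost A B C D Q R γ μ x0 d w (StochLQR.Policy.linear L) →
        ∀ k : ℕ, (k = 0 ∨ 0 < γ) → ∀ᵐ ω ∂μ,
          StochLQR.input A B C D π (x0 ω) (d · ω) (w · ω) k =
            L *ᵥ StochLQR.state A B C D π (x0 ω) (d · ω) (w · ω) k) := by
  open StochLQR in
  obtain ⟨L₀, hL₀⟩ := hadm
  obtain ⟨X, -, hX⟩ := (isAdmissible_linear_iff hW L₀).1 hL₀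
  obtain ⟨S, hS, hSL⟩ := exists_lyapunov hQ hR hγ0 hγ1 hW L₀ fun Y hY => ⟨X, hX Y hY⟩
  obtain ⟨P, hP, hPF⟩ := exists_riccatiMap_eq hQ hR hγ0 hS fun x => (hSL x).le
  have hfin := hnoise.cost_linear_ne_top hX0 hW hQ hR hγ0 hγ1 hP.posSemidef hPF
  have hexcess := hnoise.cost_eq_cost_linear_add hX0 hW hQ hR hγ0 hγ1 hP.posSemidef hPF
  set L := gain A B C D R γ P with hL
  have hmin : ∀ π : Policy n m, cost A B C D Q R γ μ x0 d w (Policy.linear L) ≤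
      cost A B C D Q R γ μ x0 d w π := by
    intro π
    by_cases hπ : cost A B C D Q R γ μ x0 d w π = ⊤
    · rw [hπ]
      exact le_top
    · rw [hexcess π hπ]
      exact le_self_add
  refine ⟨P, L, hP, hPF.symm, fun P' hP' hP'F =>
    eq_of_riccatiMap_eq hQ hR hγ0 hP' hP.posSemidef hP'F.symm hPF,
    weight_posDef hR hγ0 hP.posSemidef, hL, hfin, hmin, ⟨?_, fun b hb => ?_⟩, fun h =>
    ⟨⟨_, h, rfl⟩, ?_⟩, fun π hπ k hk => ?_⟩
  · rintro _ ⟨π, -, rfl⟩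
    exact hmin π
  · obtain ⟨c, hc, hform⟩ := exists_expForm_le (A := A) (B := B) (C := C) (D := D) (μ := μ)
      (x0 := x0) (d := d) (w := w) hQ hR S
    have hr : ENNReal.ofReal γ < 1 := by simpa using hγ1
    set r := ENNReal.ofReal γ
    set Z := ∑' k : ℕ, r ^ k * (r * ENNReal.ofReal (S * W).trace)
    have hZ : Z ≠ ⊤ := tsum_pow_mul_ne_top hr
      (ENNReal.mul_ne_top ENNReal.ofReal_ne_top ENNReal.ofReal_ne_top)
    -- The form of `S` at the switching time is dominated by the stage cost there, so the penalty is
    -- controlled by the `N`th term of the finite cost series plus `r ^ N * Z`.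
    have hbound : ∀ N : ℕ, b ≤ cost A B C D Q R γ μ x0 d w (Policy.linear L)
        + (c * (r ^ N * expStageCost A B C D Q R μ x0 d w (Policy.linear L) N) + r ^ N * Z) := by
      intro N
      let K : ℕ → Matrix (Fin m) (Fin n) ℝ := fun k => if k < N then L else L₀
      have hlt : ∀ j < N, (Policy.timeLinear K).act j = (Policy.linear L).act j := fun j hj => by
        simp only [Policy.timeLinear, Policy.linear, K, hj, if_true]
      have hK : ∀ j, N ≤ j → K j = L₀ := fun j hj => if_neg hj.not_gt
      have hge : ∀ j, N ≤ j → (Policy.timeLinear K).act j = (Policy.linear L₀).act j :=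
        fun j hj => by simp only [Policy.timeLinear, Policy.linear, hK j hj]
      calc b ≤ cost A B C D Q R γ μ x0 d w (Policy.timeLinear K) :=
            hb ⟨_, isAdmissible_switch hW hL₀ hK, rfl⟩
        _ ≤ _ := hnoise.cost_switch_le hW hQ hR hγ0 hS hSL hlt hge
        _ ≤ cost A B C D Q R γ μ x0 d w (Policy.linear L) + r ^ N *
            (c * expStageCost A B C D Q R μ x0 d w (Policy.linear L) N + Z) := by
          gcongr
          exact hform _ _
        _ = _ := by ring
    have h1 : Tendsto (fun N : ℕ =>
        r ^ N * expStageCost A B C D Q R μ x0 d w (Policy.linear L) N) atTop (𝓝 0) := by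
      rw [hnoise.cost_eq_tsum hγ0] at hfin
      exact ENNReal.tendsto_atTop_zero_of_tsum_ne_top hfin
    have h2 := ENNReal.Tendsto.const_mul (a := c) h1 (Or.inr hc)
    have h3 := ENNReal.Tendsto.mul_const (b := Z)
      (ENNReal.tendsto_pow_atTop_nhds_zero_of_lt_one hr) (Or.inr hZ)
    have h4 := (h2.add h3).const_add (cost A B C D Q R γ μ x0 d w (Policy.linear L))
    simp only [mul_zero, zero_mul, add_zero] at h4
    exact ge_of_tendsto' h4 hbound
  · rintro _ ⟨π, -, rfl⟩
    exact hmin π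
  · have hsum := hexcess π (hπ ▸ hfin)
    rw [hπ] at hsum
    -- Equal finite costs cancel, leaving a vanishing sum of nonnegative gaps.
    have hzero := (ENNReal.add_right_inj hfin).1 (hsum.symm.trans (add_zero _).symm)
    have hk0 := ENNReal.tsum_eq_zero.1 hzero k
    refine hnoise.ae_eq_of_expGap_eq_zero (weight_posDef hR hγ0 hP.posSemidef)
      ((mul_eq_zero.1 hk0).resolve_left ?_)
    -- At time `0` the discount factor is `1` even for `γ = 0`; later it is nonzero only if `γ > 0`.
    rcases hk with rfl | hγ
    · simp
    · exact pow_ne_zero _ (ENNReal.ofReal_pos.2 hγ).ne'
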